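/- **Setting.** Let $(\Gamma,d)$ be a metric space (the sites) and let $F:[0,\infty)\to(0,\infty)$ be non-increasing with $$\sup_{x}\sum_{y\in\Gamma}F(d(x,y))<\infty,\qquad \sup_{x,y}\sum_{z\in\Gamma}\frac{F(d(x,z))F(d(z,y))}{F(d(x,y))}<\infty .$$ For $a>0$ put $F_a(r)=e^{-ar}F(r)$ and $C_a=\sup_{x,y}\sum_{z}F_a(d(x,z))F_a(d(z,y))/F_a(d(x,y))$. *Harmonic dynamics.* Let $\mathcal D$ be a real-linear subspace of $\ell^2(\Gamma)$ (complex-valued functions) with a non-degenerate, real-bilinear, antisymmetric form $\sigma$ (for instance $\sigma(f,g)=\operatorname{Im}\langle f,g\rangle$), and let $\mathcal W=\mathcal W(\mathcal D)$ be the CCR algebra, i.e. the $C^*$-algebra generated by Weyl operators $W(f)\neq 0$, $f\in\mathcal D$, with $W(f)^*=W(-f)$ and $W(f)W(g)=e^{-i\sigma(f,g)/2}W(f+g)$. Let $(T_t)_{t\in\mathbb R}$ be a group of real-linear maps of $\mathcal D$ preserving $\sigma$, and let $\tau^0_t$ be the $*$-automorphisms of $\mathcal W$ with $\tau_t^0(W(f))=W(T_tf)$.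 Assume there is $a_0>0$ such that for all $0<a\le a_0$ there are numbers $c_a,v_a>0$ with $$\bigl|1-e^{i\sigma(T_tf,g)}\bigr|\le c_a e^{v_a|t|}\sum_{x,y\in\Gamma}|f(x)||g(y)|F_a(d(x,y))\qquad (t\in\mathbb R,\ f,g\in\mathcal D).$$ Let $\rho$ be a regular (all $t\mapsto\rho(W(tf))$ are continuous) $\tau^0_t$-invariant state on $\mathcal W$ with GNS representation $\pi_\rho$, let $\mathcal M$ be the weak closure of $\pi_\rho(\mathcal W)$, and assume that $\tau^0_t$ extends to a weakly continuous one-parameter group of $*$-automorphisms of $\mathcal M$, again denoted $\tau_t^0$. We write $W(f)$ also for $\pi_\rho(W(f))$. *Perturbations.* For each finite $X\subset\Gamma$ let $\mu_X$ be a finite signed measure on $\mathbb C^X$, invariant under $z\mapsto -z$, with $z\cdot\delta_X:=\sum_{x\in X}z_x\delta_x\in\mathcal D$ for $|\mu_X|$-almost every $z$, and let $P_X=\int_{\mathbb C^X}W(z\cdot\delta_X)\,\mu_X(dz)\in\mathcal M$ (weak integral). Assume there is $a_1>0$ such that for all $0<a\le a_1$ there is $\kappa_a>0$ with $$\sum_{X\ni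 x_1,x_2}\int_{\mathbb C^X}|z_{x_1}||z_{x_2}|\,|\mu_X|(dz)\le\kappa_aF_a(d(x_1,x_2))\qquad(x_1,x_2\in\Gamma),$$ the sum being over finite $X\subset\Gamma$. For finite $\Lambda\subset\Gamma$ put $P^\Lambda=\sum_{X\subset\Lambda}P_X$ and let $\tau^{(\Lambda)}_t$ be the perturbed dynamics: the weakly continuous one-parameter group of $*$-automorphisms of $\mathcal M$ that solves, weakly, $$\tau_t^{(\Lambda)}(A)=\tau_t^0(A)+i\int_0^t\tau^{(\Lambda)}_s\bigl([P^\Lambda,\tau^0_{t-s}(A)]\bigr)\,ds\qquad(A\in\mathcal M,\ t\in\mathbb R).$$ **Theorem.** For every $0<a\le\min(a_0,a_1)$, with $c_a,v_a,\kappa_a,C_a$ as above, every finite $\Lambda\subset\Gamma$, every $t\in\mathbb R$ and all $f,g\in\mathcal D$, $$\bigl\|[\tau_t^{(\Lambda)}(W(f)),W(g)]\bigr\|\le c_a e^{(v_a+c_a\kappa_aC_a^2)|t|}\sum_{x,y\in\Gamma}|f(x)||g(y)|F_a(d(x,y)).$$ In particular the bound is uniform in $\Lambda$. -/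

import Mathlib

open scoped ENNReal InnerProductSpace ComplexOrder
open MeasureTheory

noncomputable section

namespace LiebRobinson

/-! ### Decay functions on the set of sites -/

section Decay

/-- The exponentially weighted decay function `F_a(r) = e^{-a r} F(r)`. -/
def expWeight (F : ℝ → ℝ) (a : ℝ) : ℝ → ℝ := fun r => Real.exp (-a * r) * F r

/-- The convolution constant
`sup_{x,y} ∑_z F(d(x,z)) F(d(z,y)) / F(d(x,y))`, as an extended nonnegative number. -/
def convConst (Γ : Type*) [MetricSpace Γ] (F : ℝ → ℝ) : ℝ≥0∞ :=
  ⨆ (x : Γ) (y : Γ), ∑' z : Γ, ENNReal.ofReal (F (dist x z) * F (dist z y) / F (dist x y))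

/-- `F : [0,∞) → (0,∞)` is non-increasing, uniformly summable over `Γ`, and has a finite
convolution constant. (Only the values of `F` on `[0,∞)` matter.) -/
structure IsDecayFunction (Γ : Type*) [MetricSpace Γ] (F : ℝ → ℝ) : Prop where
  pos : ∀ r, 0 ≤ r → 0 < F r
  antitone : AntitoneOn F (Set.Ici 0)
  summable : (⨆ x : Γ, ∑' y : Γ, ENNReal.ofReal (F (dist x y))) < ⊤
  conv : convConst Γ F < ⊤

end Decay

/-! ### The CCR (Weyl) algebra

For a real vector space `D` with symplectic form `σ`, the Weyl operators act on `ℓ²(D)` by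
`W(f) e_h = e^{-iσ(f,h)/2} e_{f+h}`, and the CCR algebra is the C⋆-algebra they generate. By
uniqueness of the CCR algebra this is, up to ⋆-isomorphism, the only C⋆-algebra generated by
nonzero elements satisfying the Weyl relations, if `σ` is nondegenerate. -/

section CCR

variable {D : Type*} [AddCommGroup D] [Module ℝ D]

/-- The phase `e^{-iσ(f,k)/2}`. -/
def weylPhase (σ : D →ₗ[ℝ] D →ₗ[ℝ] ℝ) (f k : D) : ℂ :=
  Complex.exp (-(Complex.I * (σ f k : ℂ) / 2))

lemma norm_weylPhase (σ : D →ₗ[ℝ] D →ₗ[ℝ] ℝ) (f k : D) : ‖weylPhase σ f k‖ = 1 := by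
  have h : -(Complex.I * (σ f k : ℂ) / 2) = ((-(σ f k) / 2 : ℝ) : ℂ) * Complex.I := by
    push_cast; ring
  rw [weylPhase, h, Complex.norm_exp_ofReal_mul_I]

lemma weylOp_summable (σ : D →ₗ[ℝ] D →ₗ[ℝ] ℝ) (f : D) (ψ : lp (fun _ : D => ℂ) 2) :
    Summable fun k => ‖weylPhase σ f k * ψ (k - f)‖ ^ (2 : ℝ≥0∞).toReal := by
  have h := (lp.memℓp ψ).summable (by simp)
  have h2 := (Equiv.subRight f).summable_iff.mpr h
  simpa [norm_mul, norm_weylPhase, Function.comp_def] using h2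

/-- The Weyl operator `W(f)` on `ℓ²(D)`: `(W(f)ψ)(k) = e^{-iσ(f,k)/2} ψ(k - f)`. -/
def weylIsometry (σ : D →ₗ[ℝ] D →ₗ[ℝ] ℝ) (f : D) :
    lp (fun _ : D => ℂ) 2 →ₗᵢ[ℂ] lp (fun _ : D => ℂ) 2 :=
    { toFun := fun ψ => ⟨fun k => weylPhase σ f k * ψ (k - f), memℓp_gen (weylOp_summable σ f ψ)⟩
      map_add' := fun ψ φ => by
        ext k
        exact mul_add _ _ _
      map_smul' := fun c ψ => by
        ext k
        exact mul_left_comm _ _ _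
      norm_map' := fun ψ => by
        rw [lp.norm_eq_tsum_rpow (by simp), lp.norm_eq_tsum_rpow (by simp)]
        congr 1
        rw [← (Equiv.subRight f).tsum_eq (fun k => ‖ψ k‖ ^ (2 : ℝ≥0∞).toReal)]
        simp [norm_weylPhase] }

/-- The Weyl operator `W(f)` on `ℓ²(D)` as a bounded operator. -/
def weylOp (σ : D →ₗ[ℝ] D →ₗ[ℝ] ℝ) (f : D) :
    lp (fun _ : D => ℂ) 2 →L[ℂ] lp (fun _ : D => ℂ) 2 :=
  (weylIsometry σ f).toContinuousLinearMap

lemma norm_weylOp (σ : D →ₗ[ℝ] D →ₗ[ℝ] ℝ) (f : D) (ψ : lp (fun _ : D => ℂ) 2) :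
    ‖weylOp σ f ψ‖ = ‖ψ‖ := (weylIsometry σ f).norm_map ψ

lemma weylOp_apply (σ : D →ₗ[ℝ] D →ₗ[ℝ] ℝ) (f k : D) (ψ : lp (fun _ : D => ℂ) 2) :
    weylOp σ f ψ k = weylPhase σ f k * ψ (k - f) := rfl

/-- The C⋆-algebra of operators on `ℓ²(D)` generated by the Weyl operators. -/
def weylSubalgebra (σ : D →ₗ[ℝ] D →ₗ[ℝ] ℝ) :
    StarSubalgebra ℂ (lp (fun _ : D => ℂ) 2 →L[ℂ] lp (fun _ : D => ℂ) 2) :=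
  (StarAlgebra.adjoin ℂ (Set.range (weylOp σ))).topologicalClosure

/-- The CCR algebra `𝒲(D)` over `(D, σ)`. -/
def CCRAlgebra (σ : D →ₗ[ℝ] D →ₗ[ℝ] ℝ) : Type _ := weylSubalgebra σ

instance (σ : D →ₗ[ℝ] D →ₗ[ℝ] ℝ) :
    IsClosed (weylSubalgebra σ :
      Set (lp (fun _ : D => ℂ) 2 →L[ℂ] lp (fun _ : D => ℂ) 2)) :=
  StarSubalgebra.isClosed_topologicalClosure _

instance (σ : D →ₗ[ℝ] D →ₗ[ℝ] ℝ) : CStarAlgebra (CCRAlgebra σ) :=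
  inferInstanceAs (CStarAlgebra (weylSubalgebra σ))

instance (σ : D →ₗ[ℝ] D →ₗ[ℝ] ℝ) : PartialOrder (CCRAlgebra σ) :=
  CStarAlgebra.spectralOrder (CCRAlgebra σ)

instance (σ : D →ₗ[ℝ] D →ₗ[ℝ] ℝ) : StarOrderedRing (CCRAlgebra σ) :=
  CStarAlgebra.spectralOrderedRing (CCRAlgebra σ)

/-- The Weyl operator `W(f)` as an element of the CCR algebra. -/
def weyl (σ : D →ₗ[ℝ] D →ₗ[ℝ] ℝ) (f : D) : CCRAlgebra σ :=
  (⟨weylOp σ f, subset_closure (StarAlgebra.subset_adjoin ℂ _ ⟨f, rfl⟩)⟩ : weylSubalgebra σ)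

/-- The Weyl relations `W(f) W(g) = e^{-iσ(f,g)/2} W(f+g)`. -/
lemma weyl_mul (σ : D →ₗ[ℝ] D →ₗ[ℝ] ℝ) (hσ : ∀ f g, σ f g = -σ g f) (f g : D) :
    weyl σ f * weyl σ g = weylPhase σ f g • weyl σ (f + g) := by
  refine Subtype.ext (ContinuousLinearMap.ext fun ψ => lp.ext (funext fun k => ?_))
  change weylPhase σ f k * (weylPhase σ g (k - f) * ψ (k - f - g)) =
    weylPhase σ f g * (weylPhase σ (f + g) k * ψ (k - (f + g)))
  rw [← mul_assoc, ← mul_assoc, sub_sub]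
  congr 1
  rw [weylPhase, weylPhase, weylPhase, weylPhase, ← Complex.exp_add, ← Complex.exp_add]
  congr 1
  rw [map_sub, hσ g f, map_add, LinearMap.add_apply]
  push_cast
  ring

/-- `W(f)^* = W(-f)`. -/
lemma star_weyl (σ : D →ₗ[ℝ] D →ₗ[ℝ] ℝ) (hσ : ∀ f g, σ f g = -σ g f) (f : D) :
    star (weyl σ f) = weyl σ (-f) := by
  have h0 : σ f f = 0 := by have := hσ f f; linarith
  have h1 : weyl σ 0 = 1 := by
    refine Subtype.ext (ContinuousLinearMap.ext fun ψ => lp.ext (funext fun k => ?_))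
    change weylPhase σ 0 k * ψ (k - 0) = ψ k
    simp [weylPhase]
  have h2 : weyl σ f * weyl σ (-f) = 1 := by
    rw [weyl_mul σ hσ, add_neg_cancel, h1]; simp [weylPhase, h0]
  have h3 : star (weyl σ f) * weyl σ f = 1 := by
    refine Subtype.ext ?_
    change ContinuousLinearMap.adjoint (weylOp σ f) ∘L weylOp σ f = 1
    exact (ContinuousLinearMap.norm_map_iff_adjoint_comp_self (weylOp σ f)).mp (norm_weylOp σ f)
  exact left_inv_eq_right_inv h3 h2

end CCR

/-! ### Weak closures, GNS representations and `W^*`-dynamics -/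

section Dynamics

variable {H : Type*} [NormedAddCommGroup H] [InnerProductSpace ℂ H] [CompleteSpace H]

/-- The identity map from the bounded operators to the bounded operators with the weak operator
topology, as a ⋆-homomorphism. -/
def toWOT (H : Type*) [NormedAddCommGroup H] [InnerProductSpace ℂ H] [CompleteSpace H] :
    (H →L[ℂ] H) →⋆ₐ[ℂ] (H →WOT[ℂ] H) where
  toFun := ContinuousLinearMapWOT.ofCLM
  map_one' := rfl
  map_mul' _ _ := rfl
  map_zero' := rfl
  map_add' _ _ := rfl
  commutes' _ := rfl
  map_star' _ := rfl

/-- The closure of a ⋆-algebra of bounded operators in the weak operator topology. -/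
def weakClosure (S : StarSubalgebra ℂ (H →L[ℂ] H)) : StarSubalgebra ℂ (H →L[ℂ] H) :=
  (S.map (toWOT H)).topologicalClosure.comap (toWOT H)

/-- A functional on `M` is σ-weakly continuous if it is of the form `A ↦ ∑_n ⟨ξ_n, A η_n⟩` with
square-summable sequences of vectors `ξ_n`, `η_n`. -/
def IsSigmaWeaklyContinuous (M : StarSubalgebra ℂ (H →L[ℂ] H)) (ω : M → ℂ) : Prop :=
  ∃ ξ η : ℕ → H, (Summable fun n => ‖ξ n‖ ^ 2) ∧ (Summable fun n => ‖η n‖ ^ 2) ∧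
    ∀ A : M, HasSum (fun n => ⟪ξ n, (A : H →L[ℂ] H) (η n)⟫_ℂ) (ω A)

/-- A weakly continuous one-parameter group of ⋆-automorphisms of an algebra `M` of bounded
operators. As usual for σ-weakly continuous groups, this means continuity in `t` for each `A ∈ M`
and σ-weak continuity of each map `evol t`; if `M` is a von Neumann algebra then the latter holds
automatically for every ⋆-automorphism. -/
structure WStarDynamics (M : StarSubalgebra ℂ (H →L[ℂ] H)) where
  /-- The automorphism at time `t`. -/
  evol : ℝ → (M ≃⋆ₐ[ℂ] M)
  evol_zero : ∀ A, evol 0 A = A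
  evol_add : ∀ s t A, evol (s + t) A = evol s (evol t A)
  normal : ∀ (t : ℝ) (φ ψ : H),
    IsSigmaWeaklyContinuous M fun A => ⟪φ, (evol t A : H →L[ℂ] H) ψ⟫_ℂ
  weak_continuous : ∀ A : M, Continuous fun t => toWOT H (evol t A : H →L[ℂ] H)

/-- `β` is the perturbation of the dynamics `α` by the element `P`, i.e. it solves
`β_t(A) = α_t(A) + i ∫_0^t β_s([P, α_{t-s}(A)]) ds`, with the integral understood weakly. -/
def IsPerturbedDynamics {M : StarSubalgebra ℂ (H →L[ℂ] H)} (α : WStarDynamics M) (P : M)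
    (β : WStarDynamics M) : Prop :=
  ∀ (t : ℝ) (A : M) (φ ψ : H),
    IntervalIntegrable
      (fun s => ⟪φ, (β.evol s ⁅P, α.evol (t - s) A⁆ : H →L[ℂ] H) ψ⟫_ℂ) volume 0 t ∧
    ⟪φ, (β.evol t A : H →L[ℂ] H) ψ⟫_ℂ = ⟪φ, (α.evol t A : H →L[ℂ] H) ψ⟫_ℂ +
      Complex.I * ∫ s in (0 : ℝ)..t, ⟪φ, (β.evol s ⁅P, α.evol (t - s) A⁆ : H →L[ℂ] H) ψ⟫_ℂ

/-- The integral of a complex function against a (finite) signed measure. -/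
def signedIntegral {Z : Type*} [MeasurableSpace Z] (μ : SignedMeasure Z) (u : Z → ℂ) : ℂ :=
  (∫ z, u z ∂μ.toJordanDecomposition.posPart) - ∫ z, u z ∂μ.toJordanDecomposition.negPart

/-- `B = ∫ G(z) μ(dz)` as a weak integral of an operator-valued function. -/
def IsWeakIntegral {Z : Type*} [MeasurableSpace Z] (μ : SignedMeasure Z) (G : Z → (H →L[ℂ] H))
    (B : H →L[ℂ] H) : Prop :=
  ∀ φ ψ : H, Integrable (fun z => ⟪φ, G z ψ⟫_ℂ) μ.totalVariation ∧
    ⟪φ, B ψ⟫_ℂ = signedIntegral μ fun z => ⟪φ, G z ψ⟫_ℂ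

variable {D : Type*} [AddCommGroup D] [Module ℝ D] {σ : D →ₗ[ℝ] D →ₗ[ℝ] ℝ}

/-- The von Neumann algebra `ℳ = \overline{π_ρ(𝒲(D))}`, the weak closure of the image of the CCR
algebra in the GNS representation of `ρ`. -/
def gnsAlgebra (ρ : CCRAlgebra σ →ₚ[ℂ] ℂ) : StarSubalgebra ℂ (ρ.GNS →L[ℂ] ρ.GNS) :=
  weakClosure ρ.gnsStarAlgHom.range

/-- The representation `π_ρ`, with values in `ℳ`. -/
def gnsRep (ρ : CCRAlgebra σ →ₚ[ℂ] ℂ) (A : CCRAlgebra σ) : gnsAlgebra ρ :=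
  ⟨ρ.gnsStarAlgHom A, subset_closure ⟨ρ.gnsStarAlgHom A, ⟨A, rfl⟩, rfl⟩⟩

/-- The state `ρ` is regular: `t ↦ ρ(W(tf))` is continuous for all `f`. -/
def IsRegularState (ρ : CCRAlgebra σ →ₚ[ℂ] ℂ) : Prop :=
  ρ 1 = 1 ∧ ∀ f : D, Continuous fun t : ℝ => ρ (weyl σ (t • f))

end Dynamics

/-! ### Lattice functions and perturbations -/

section Lattice

variable {Γ : Type*}

/-- The function `z · δ_X = ∑_{x ∈ X} z_x δ_x` on `Γ`. -/
def deltaComb (X : Finset Γ) (z : X → ℂ) : lp (fun _ : Γ => ℂ) 2 :=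
  open scoped Classical in ∑ x : X, lp.single 2 (x : Γ) (z x)

/-- The sum `∑_{x,y} |f(x)| |g(y)| F(d(x,y))`. -/
def pairSum [MetricSpace Γ] (F : ℝ → ℝ) (f g : lp (fun _ : Γ => ℂ) 2) : ℝ :=
  ∑' p : Γ × Γ, ‖f p.1‖ * ‖g p.2‖ * F (dist p.1 p.2)

/-- The represented Weyl operator `π_ρ(W(z · δ_X))`; it is set to `0` at those `z` for which
`z · δ_X ∉ D`, and these `z` always form a null set below. -/
def weylAt {D : Submodule ℝ (lp (fun _ : Γ => ℂ) 2)} {σ : D →ₗ[ℝ] D →ₗ[ℝ] ℝ}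
    (ρ : CCRAlgebra σ →ₚ[ℂ] ℂ) (X : Finset Γ) (z : X → ℂ) : ρ.GNS →L[ℂ] ρ.GNS :=
  open scoped Classical in
  if h : deltaComb X z ∈ D then ρ.gnsStarAlgHom (weyl σ ⟨deltaComb X z, h⟩) else 0

/-- The sum `∑_{X ∋ x₁, x₂} ∫ |z_{x₁}| |z_{x₂}| |μ_X|(dz)` over all finite sets of sites `X`
containing `x₁` and `x₂`. -/
def pairMoment (μ : ∀ X : Finset Γ, SignedMeasure (X → ℂ)) (x₁ x₂ : Γ) : ℝ≥0∞ :=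
  ∑' X : {X : Finset Γ // x₁ ∈ X ∧ x₂ ∈ X},
    ∫⁻ z : X.1 → ℂ, ‖z ⟨x₁, X.2.1⟩‖ₑ * ‖z ⟨x₂, X.2.2⟩‖ₑ ∂(μ X.1).totalVariation

end Lattice

end LiebRobinson

end

open LiebRobinson

noncomputable section

namespace LiebRobinson

/-! ### Convolution estimates for decay functions -/

/-! The proof works in the interaction picture. For fixed `t` and `f`, the unitaries `Φ s =
β_s(W(T_{t-s} f))` join `W(T_t f)` at `s = 0` to `β_t(W f)` at `s = t` and satisfy `Φ' = i L Φ`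
weakly, with `L s = β_s(P - W(h) P W(-h))` and `h = T_{t-s} f`. Conjugating `B = W(g)` by `Φ` shows
that `‖[Φ, B]‖` grows at rate at most `‖[L, B]‖` (`IsWeakSolution.norm_commutator_le`): the large
operator `P` enters only through its difference from its Weyl conjugate.

Conjugating one Weyl operator by another only produces a phase, so `L` is a superposition of the
operators `β_s(W(z·δ_X))` weighted by `1 - e^{-iσ(h, z·δ_X)}`, and these weights are small by the
bound on the harmonic dynamics. This yields a closed linear integral inequality for the commutator
norms. In it the kernel `F_a` appears three times in a row, twice from commutator bounds and once
from the moment condition; two convolutions reduce this to one kernel at the cost of `C_a^2`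
(`IsDecayFunction.tsum_smear_kern_smear_le`).

The inequality is iterated from the trivial bound `2`
(`IsMultisitePerturbation.norm_lie_evol_le_exp`). The stated exponential is a fixed point of the
iteration. The remainder depends on `Λ`, but after `n` steps it carries a factor `(m|t|)^n / n!` and
disappears in the limit. -/

lemma tsum_enorm_sq_lt_top {Γ : Type*} (f : lp (fun _ : Γ => ℂ) 2) : ∑' x, ‖f x‖ₑ ^ 2 < ⊤ := by
  have h := (lp.memℓp f).summable (by simp)
  have h2 : ∀ x, ‖f x‖ₑ ^ 2 = ENNReal.ofReal (‖f x‖ ^ (2 : ℝ≥0∞).toReal) := fun x => by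
    rw [← ofReal_norm, ← ENNReal.ofReal_pow (norm_nonneg _)]
    simp
  simp_rw [h2]
  rw [← ENNReal.ofReal_tsum_of_nonneg (fun x => by positivity) h]
  exact ENNReal.ofReal_lt_top

section Kernel

variable {Γ : Type*} [MetricSpace Γ] {G : ℝ → ℝ}

/-- The matrix `G(d(x,y))` with extended nonnegative entries. -/
def kern (G : ℝ → ℝ) (x y : Γ) : ℝ≥0∞ := ENNReal.ofReal (G (dist x y))

/-- The product of the row vector `u` with the matrix `G(d(x,y))`. -/
def smear (G : ℝ → ℝ) (u : Γ → ℝ≥0∞) (y : Γ) : ℝ≥0∞ := ∑' x, u x * kern G x y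

/-- The sum `∑_{x,y} u(x) G(d(x,y)) w(y)` with values in `[0,∞]`. -/
def pairing (G : ℝ → ℝ) (u w : Γ → ℝ≥0∞) : ℝ≥0∞ := ∑' y, smear G u y * w y

lemma kern_comm (G : ℝ → ℝ) (x y : Γ) : kern G x y = kern G y x := by
  rw [kern, kern, dist_comm]

/-- The matrix is symmetric, so smearing can be moved from one factor to the other by Tonelli. -/
lemma tsum_smear_mul (G : ℝ → ℝ) (u w : Γ → ℝ≥0∞) :
    ∑' y, smear G u y * w y = ∑' x, u x * smear G w x := by
  simp_rw [smear, ← ENNReal.tsum_mul_right, ← ENNReal.tsum_mul_left]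
  rw [ENNReal.tsum_comm]
  exact tsum_congr fun x => tsum_congr fun y => by rw [kern_comm G y x]; ring

lemma pairing_comm (G : ℝ → ℝ) (u w : Γ → ℝ≥0∞) : pairing G u w = pairing G w u := by
  rw [pairing, tsum_smear_mul, pairing]
  exact tsum_congr fun x => mul_comm _ _

/-- By the triangle inequality the exponential weight of a path through `z` is at most that of the
direct distance, so the weight does not increase the convolution constant. -/
lemma IsDecayFunction.expWeight {F : ℝ → ℝ} (hF : IsDecayFunction Γ F) {a : ℝ} (ha : 0 ≤ a) :
    IsDecayFunction Γ (expWeight F a) where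
  pos r hr := mul_pos (Real.exp_pos _) (hF.pos r hr)
  antitone r hr s hs hrs := by
    refine mul_le_mul (Real.exp_le_exp.2 ?_) (hF.antitone hr hs hrs) (hF.pos s hs).le
      (Real.exp_pos _).le
    nlinarith
  summable := by
    refine lt_of_le_of_lt (iSup_mono fun x => ENNReal.tsum_le_tsum fun y => ?_) hF.summable
    refine ENNReal.ofReal_le_ofReal (mul_le_of_le_one_left (hF.pos _ dist_nonneg).le ?_)
    exact Real.exp_le_one_iff.2 (by nlinarith [dist_nonneg (x := x) (y := y)])
  conv := by
    refine lt_of_le_of_lt (iSup₂_mono fun x y => ENNReal.tsum_le_tsum fun z => ?_) hF.conv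
    refine ENNReal.ofReal_le_ofReal ?_
    have hxy := hF.pos _ (dist_nonneg (x := x) (y := y))
    have hxz := hF.pos _ (dist_nonneg (x := x) (y := z))
    have hzy := hF.pos _ (dist_nonneg (x := z) (y := y))
    have he : Real.exp (-a * dist x z) * Real.exp (-a * dist z y) ≤ Real.exp (-a * dist x y) := by
      rw [← Real.exp_add]
      refine Real.exp_le_exp.2 ?_
      nlinarith [dist_triangle x z y]
    simp only [LiebRobinson.expWeight]
    rw [div_le_div_iff₀ (by positivity) hxy]
    calc _ = (Real.exp (-a * dist x z) * Real.exp (-a * dist z y)) *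
          (F (dist x z) * F (dist z y) * F (dist x y)) := by ring
      _ ≤ Real.exp (-a * dist x y) * (F (dist x z) * F (dist z y) * F (dist x y)) := by gcongr
      _ = _ := by ring

lemma IsDecayFunction.tsum_kern_mul_kern_le (hG : IsDecayFunction Γ G) (x y : Γ) :
    ∑' z, kern G x z * kern G z y ≤ convConst Γ G * kern G x y := by
  have hxy := hG.pos _ (dist_nonneg (x := x) (y := y))
  have h : ∀ z, kern G x z * kern G z y =
      ENNReal.ofReal (G (dist x z) * G (dist z y) / G (dist x y)) * kern G x y := fun z => by
    have hxz := hG.pos _ (dist_nonneg (x := x) (y := z))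
    have hzy := hG.pos _ (dist_nonneg (x := z) (y := y))
    rw [kern, kern, kern, ← ENNReal.ofReal_mul hxz.le, ← ENNReal.ofReal_mul (by positivity),
      div_mul_cancel₀ _ hxy.ne']
  simp_rw [h, ENNReal.tsum_mul_right]
  gcongr
  exact le_iSup₂ (f := fun x y : Γ => ∑' z : Γ,
    ENNReal.ofReal (G (dist x z) * G (dist z y) / G (dist x y))) x y

lemma IsDecayFunction.smear_smear_le (hG : IsDecayFunction Γ G) (u : Γ → ℝ≥0∞) (y : Γ) :
    smear G (smear G u) y ≤ convConst Γ G * smear G u y := by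
  calc smear G (smear G u) y = ∑' x, u x * ∑' z, kern G x z * kern G z y := by
        simp_rw [smear, ← ENNReal.tsum_mul_right, ← ENNReal.tsum_mul_left]
        rw [ENNReal.tsum_comm]
        simp_rw [mul_assoc]
    _ ≤ ∑' x, u x * (convConst Γ G * kern G x y) := by
        gcongr with x
        exact hG.tsum_kern_mul_kern_le x y
    _ = _ := by
        rw [smear, ← ENNReal.tsum_mul_left]
        exact tsum_congr fun x => by ring

/-- Three consecutive kernels collapse to one through two uses of the convolution bound; this is the
origin of `C_a^2` in the exponent. -/
lemma IsDecayFunction.tsum_smear_kern_smear_le (hG : IsDecayFunction Γ G) (u w : Γ → ℝ≥0∞) :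
    ∑' x, ∑' y, smear G u x * kern G x y * smear G w y ≤ convConst Γ G ^ 2 * pairing G u w := by
  calc ∑' x, ∑' y, smear G u x * kern G x y * smear G w y
      = ∑' y, smear G (smear G u) y * smear G w y := by
        rw [ENNReal.tsum_comm]
        simp_rw [ENNReal.tsum_mul_right]
        rfl
    _ = ∑' y, smear G (smear G (smear G u)) y * w y := (tsum_smear_mul G _ _).symm
    _ ≤ ∑' y, convConst Γ G ^ 2 * (smear G u y * w y) := by
        refine ENNReal.tsum_le_tsum fun y => ?_
        rw [← mul_assoc]
        gcongr
        refine (hG.smear_smear_le _ y).trans ?_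
        rw [sq, mul_assoc]
        gcongr
        exact hG.smear_smear_le _ y
    _ = _ := ENNReal.tsum_mul_left

lemma pairing_eq_tsum (G : ℝ → ℝ) (u w : Γ → ℝ≥0∞) :
    pairing G u w = ∑' x, ∑' y, u x * w y * kern G x y := by
  rw [pairing, tsum_smear_mul]
  simp_rw [smear, ← ENNReal.tsum_mul_left]
  exact tsum_congr fun x => tsum_congr fun y => by rw [kern_comm G y x]; ring

/-- Schur's test: separate the factors by `pq ≤ p² + q²`, then bound row and column sums of the
symmetric kernel uniformly. -/
lemma IsDecayFunction.pairing_lt_top (hG : IsDecayFunction Γ G) (f g : lp (fun _ : Γ => ℂ) 2) :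
    pairing G (fun x => ‖f x‖ₑ) (fun x => ‖g x‖ₑ) < ⊤ := by
  set S := ⨆ x : Γ, ∑' y : Γ, ENNReal.ofReal (G (dist x y)) with hS
  have hrow : ∀ x : Γ, ∑' y, kern G x y ≤ S := fun x =>
    le_iSup (fun x : Γ => ∑' y : Γ, ENNReal.ofReal (G (dist x y))) x
  have hST : S < ⊤ := hG.summable
  have hmul : ∀ p q : ℝ≥0∞, p * q ≤ p ^ 2 + q ^ 2 := fun p q => by
    rcases le_total p q with h | h
    · exact (mul_le_mul_left h q).trans ((sq q).symm.le.trans le_add_self)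
    · exact (mul_le_mul_right h p).trans ((sq p).symm.le.trans le_self_add)
  rw [pairing_eq_tsum]
  calc ∑' x, ∑' y, ‖f x‖ₑ * ‖g y‖ₑ * kern G x y
      ≤ ∑' x, ∑' y, (‖f x‖ₑ ^ 2 * kern G x y + ‖g y‖ₑ ^ 2 * kern G x y) := by
        gcongr with x y
        rw [← add_mul]
        gcongr
        exact hmul _ _
    _ = (∑' x, ‖f x‖ₑ ^ 2 * ∑' y, kern G x y) + ∑' y, ‖g y‖ₑ ^ 2 * ∑' x, kern G y x := by
        simp_rw [ENNReal.tsum_add]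
        congr 1
        · simp_rw [ENNReal.tsum_mul_left]
        · rw [ENNReal.tsum_comm]
          simp_rw [ENNReal.tsum_mul_left, kern_comm G]
    _ ≤ (∑' x, ‖f x‖ₑ ^ 2 * S) + ∑' y, ‖g y‖ₑ ^ 2 * S := by
        gcongr <;> exact hrow _
    _ < ⊤ := by
        rw [ENNReal.tsum_mul_right, ENNReal.tsum_mul_right]
        exact ENNReal.add_lt_top.2 ⟨ENNReal.mul_lt_top (tsum_enorm_sq_lt_top f) hST,
          ENNReal.mul_lt_top (tsum_enorm_sq_lt_top g) hST⟩

lemma IsDecayFunction.pairSum_nonneg (hG : IsDecayFunction Γ G) (f g : lp (fun _ : Γ => ℂ) 2) :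
    0 ≤ pairSum G f g :=
  tsum_nonneg fun p => mul_nonneg (by positivity) (hG.pos _ dist_nonneg).le

/-- A real `tsum` is `0` by default when the family is not summable; Schur's test excludes this, so
all estimates can be made in `[0,∞]`. -/
lemma IsDecayFunction.ofReal_pairSum (hG : IsDecayFunction Γ G) (f g : lp (fun _ : Γ => ℂ) 2) :
    ENNReal.ofReal (pairSum G f g) = pairing G (fun x => ‖f x‖ₑ) (fun x => ‖g x‖ₑ) := by
  have h0 : ∀ p : Γ × Γ, 0 ≤ ‖f p.1‖ * ‖g p.2‖ * G (dist p.1 p.2) := fun p =>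
    mul_nonneg (by positivity) (hG.pos _ dist_nonneg).le
  have h1 : ∀ p : Γ × Γ, ENNReal.ofReal (‖f p.1‖ * ‖g p.2‖ * G (dist p.1 p.2)) =
      ‖f p.1‖ₑ * ‖g p.2‖ₑ * kern G p.1 p.2 := fun p => by
    rw [ENNReal.ofReal_mul (by positivity), ENNReal.ofReal_mul (by positivity),
      ofReal_norm, ofReal_norm, kern]
  have h2 : ∑' p : Γ × Γ, ENNReal.ofReal (‖f p.1‖ * ‖g p.2‖ * G (dist p.1 p.2)) =
      pairing G (fun x => ‖f x‖ₑ) (fun x => ‖g x‖ₑ) := by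
    simp_rw [h1]
    rw [pairing_eq_tsum, ENNReal.tsum_prod']
  have h3 : Summable fun p : Γ × Γ => ‖f p.1‖ * ‖g p.2‖ * G (dist p.1 p.2) := by
    have := ENNReal.summable_toReal (h2.trans_lt (hG.pairing_lt_top f g)).ne
    exact this.congr fun p => ENNReal.toReal_ofReal (h0 p)
  rw [pairSum, ENNReal.ofReal_tsum_of_nonneg h0 h3, h2]

end Kernel

/-! ### Finitely supported test functions -/

section DeltaComb

variable {Γ : Type*}

lemma deltaComb_apply_mem (X : Finset Γ) (z : X → ℂ) (x : X) : deltaComb X z x = z x := by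
  classical
  simp only [deltaComb, lp.coeFn_sum, Finset.sum_apply, lp.single_apply]
  rw [Finset.sum_eq_single x]
  · simp
  · intro b _ hb
    rw [Pi.single_eq_of_ne]
    exact fun h => hb (Subtype.ext h.symm)
  · simp

lemma deltaComb_apply_notMem (X : Finset Γ) (z : X → ℂ) {x : Γ} (hx : x ∉ X) :
    deltaComb X z x = 0 := by
  classical
  simp only [deltaComb, lp.coeFn_sum, Finset.sum_apply, lp.single_apply]
  refine Finset.sum_eq_zero fun b _ => ?_
  rw [Pi.single_eq_of_ne]
  rintro rfl
  exact hx b.2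

lemma pairing_deltaComb [MetricSpace Γ] (G : ℝ → ℝ) (u : Γ → ℝ≥0∞) (X : Finset Γ) (z : X → ℂ) :
    pairing G u (fun x => ‖deltaComb X z x‖ₑ) = ∑ x : X, smear G u x * ‖z x‖ₑ := by
  rw [pairing, tsum_eq_sum (s := X) fun x hx => by rw [deltaComb_apply_notMem X z hx]; simp,
    ← Finset.sum_coe_sort]
  exact Finset.sum_congr rfl fun x _ => by rw [deltaComb_apply_mem]

end DeltaComb

/-! ### Commutators along an interaction-picture evolution -/

section Interpolation

variable {H : Type*} [NormedAddCommGroup H] [InnerProductSpace ℂ H]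

/-- Test with `φ = A ψ` and cancel one factor `‖A ψ‖`. -/
lemma norm_le_of_norm_inner_le (A : H →L[ℂ] H) {C : ℝ} (hC : 0 ≤ C)
    (h : ∀ φ ψ : H, ‖⟪φ, A ψ⟫_ℂ‖ ≤ C * ‖φ‖ * ‖ψ‖) : ‖A‖ ≤ C := by
  refine A.opNorm_le_bound hC fun ψ => ?_
  have h1 := h (A ψ) ψ
  rw [inner_self_eq_norm_sq_to_K] at h1
  simp only [norm_pow, Complex.coe_algebraMap, Complex.norm_real, norm_norm] at h1
  rcases (norm_nonneg (A ψ)).eq_or_lt with h0 | h0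
  · rw [← h0]; positivity
  · nlinarith

/-- A function whose increments over `[x,y]` are bounded by those of `β`, up to an error of
second order in `y - x`, has increments bounded by those of `β`. -/
lemma norm_sub_le_of_second_order {E : Type*} [NormedAddCommGroup E] (q : ℝ → E) (β : ℝ → ℝ)
    (C t : ℝ) (h : ∀ x y : ℝ, 0 ≤ x → x ≤ y → y ≤ 1 →
      ‖q (t * y) - q (t * x)‖ ≤ β y - β x + C * (y - x) ^ 2) :
    ‖q t - q 0‖ ≤ β 1 - β 0 := by
  -- Cut `[0,1]` into `n + 1` equal pieces: the increments of `β` telescope and the `n + 1`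
  -- quadratic errors add up to `C / (n + 1)`.
  have hn : ∀ n : ℕ, ‖q t - q 0‖ ≤ β 1 - β 0 + C * (1 / ((n : ℝ) + 1)) := fun n => by
    have hn0 : (0 : ℝ) < (n : ℝ) + 1 := by positivity
    have hk : ∀ k : ℕ, k ≤ n + 1 → ‖q (t * (k / (n + 1))) - q 0‖ ≤
        β (k / (n + 1)) - β 0 + k * (C * (1 / ((n : ℝ) + 1)) ^ 2) := by
      intro k
      induction k with
      | zero => intro _; simp
      | succ k ih =>
        intro hk
        have h1 := ih (by omega)
        have h2 := h (k / (n + 1)) ((k + 1 : ℕ) / (n + 1)) (by positivity)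
          (by gcongr; simp) ((div_le_one hn0).2 (by exact_mod_cast hk))
        have h3 : ((k + 1 : ℕ) / ((n : ℝ) + 1) - k / (n + 1)) = 1 / ((n : ℝ) + 1) := by
          push_cast; field_simp; ring
        rw [h3] at h2
        have h4 := norm_sub_le_norm_sub_add_norm_sub (q (t * ((k + 1 : ℕ) / ((n : ℝ) + 1))))
          (q (t * (k / (n + 1)))) (q 0)
        push_cast at *
        linarith
    have h1 := hk (n + 1) le_rfl
    have h2 : ((n + 1 : ℕ) : ℝ) / ((n : ℝ) + 1) = 1 := by push_cast; field_simp
    rw [h2, mul_one] at h1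
    refine h1.trans (le_of_eq ?_)
    push_cast
    field_simp
  have hlim : Filter.Tendsto (fun n : ℕ => β 1 - β 0 + C * (1 / ((n : ℝ) + 1))) Filter.atTop
      (nhds (β 1 - β 0 + C * 0)) :=
    tendsto_const_nhds.add (tendsto_one_div_add_atTop_nhds_zero_nat.const_mul C)
  simpa using ge_of_tendsto' hlim hn

variable {Φ Λ : ℝ → H →L[ℂ] H} {B : H →L[ℂ] H} {C : ℝ}

/-- `Φ` solves `Φ' = i Λ Φ` in the weak sense. -/
def IsWeakSolution (Φ Λ : ℝ → H →L[ℂ] H) : Prop :=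
  ∀ (r : ℝ) (φ ψ : H), IntervalIntegrable (fun s => ⟪φ, (Λ s * Φ s) ψ⟫_ℂ) volume 0 r ∧
    ⟪φ, Φ r ψ⟫_ℂ = ⟪φ, Φ 0 ψ⟫_ℂ + Complex.I * ∫ s in (0 : ℝ)..r, ⟪φ, (Λ s * Φ s) ψ⟫_ℂ

lemma IsWeakSolution.intervalIntegrable (h : IsWeakSolution Φ Λ) (r r' : ℝ) (φ ψ : H) :
    IntervalIntegrable (fun s => ⟪φ, (Λ s * Φ s) ψ⟫_ℂ) volume r r' :=
  (h r φ ψ).1.symm.trans (h r' φ ψ).1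

lemma IsWeakSolution.inner_sub (h : IsWeakSolution Φ Λ) (r r' : ℝ) (φ ψ : H) :
    ⟪φ, (Φ r' - Φ r) ψ⟫_ℂ = Complex.I * ∫ s in r..r', ⟪φ, (Λ s * Φ s) ψ⟫_ℂ := by
  rw [← intervalIntegral.integral_interval_sub_left (h r' φ ψ).1 (h r φ ψ).1, mul_sub,
    sub_apply, _root_.inner_sub_right, (h r' φ ψ).2, (h r φ ψ).2]
  ring

variable [CompleteSpace H]

lemma norm_le_one_of_mem_unitary {U : H →L[ℂ] H} (hU : U ∈ unitary (H →L[ℂ] H)) : ‖U‖ ≤ 1 := by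
  have h : ‖U‖ * ‖U‖ ≤ 1 := by
    rw [← CStarRing.norm_star_mul_self, (Unitary.mem_iff.1 hU).1]
    exact ContinuousLinearMap.norm_id_le
  nlinarith [norm_nonneg U]

/-- Although the equation holds only weakly, a bounded generator makes the solution Lipschitz in
norm; this controls the second-order errors below. -/
lemma IsWeakSolution.norm_sub_le (h : IsWeakSolution Φ Λ) (hΦ : ∀ s, Φ s ∈ unitary (H →L[ℂ] H))
    (hΛ : ∀ s, ‖Λ s‖ ≤ C) (r r' : ℝ) : ‖Φ r' - Φ r‖ ≤ C * |r' - r| := by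
  have hC : 0 ≤ C := (norm_nonneg _).trans (hΛ 0)
  refine norm_le_of_norm_inner_le _ (by positivity) fun φ ψ => ?_
  rw [h.inner_sub, norm_mul, Complex.norm_I, one_mul]
  refine (intervalIntegral.norm_integral_le_of_norm_le_const (C := C * ‖φ‖ * ‖ψ‖)
    fun s _ => ?_).trans (le_of_eq (by ring))
  have h1 : ‖Λ s * Φ s‖ ≤ C :=
    (norm_mul_le _ _).trans ((mul_le_mul (hΛ s) (norm_le_one_of_mem_unitary (hΦ s))
      (norm_nonneg _) hC).trans (mul_one C).le)
  calc ‖⟪φ, (Λ s * Φ s) ψ⟫_ℂ‖ ≤ ‖φ‖ * ‖(Λ s * Φ s) ψ‖ := norm_inner_le_norm _ _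
    _ ≤ ‖φ‖ * (C * ‖ψ‖) := by
        gcongr
        exact (ContinuousLinearMap.le_opNorm _ _).trans (by gcongr)
    _ = _ := by ring

/-- This replaces the product rule for `Φ* B Φ`, which is not at hand for weak derivatives. Over a
finite increment, replacing `Φ s` by `Φ r` inside the integral leaves the commutator of `B` with `Λ
s`, up to a second-order error. The majorant `b` avoids any measurability question for commutator
norms. -/
lemma IsWeakSolution.norm_conj_sub_le (h : IsWeakSolution Φ Λ)
    (hΦ : ∀ s, Φ s ∈ unitary (H →L[ℂ] H)) (hΛ : ∀ s, ‖Λ s‖ ≤ C) (hB : ‖B‖ ≤ 1) {b : ℝ → ℝ}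
    (hb : Continuous b) (r r' : ℝ) (hbΛ : ∀ s ∈ Set.uIcc r r', ‖B * Λ s - Λ s * B‖ ≤ b s) :
    ‖star (Φ r') * B * Φ r' - star (Φ r) * B * Φ r‖ ≤
      |∫ s in r..r', b s| + 2 * C ^ 2 * |r' - r| ^ 2 := by
  have hC : 0 ≤ C := (norm_nonneg _).trans (hΛ 0)
  have hΦ1 : ∀ s, star (Φ s) * Φ s = 1 := fun s => (Unitary.mem_iff.1 (hΦ s)).1
  have hΦ2 : ∀ s, Φ s * star (Φ s) = 1 := fun s => (Unitary.mem_iff.1 (hΦ s)).2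
  have hΦn : ∀ s, ‖Φ s‖ ≤ 1 := fun s => norm_le_one_of_mem_unitary (hΦ s)
  have hΦs : ∀ s, ‖star (Φ s)‖ ≤ 1 := fun s => (norm_star _).trans_le (hΦn s)
  -- With this `V` the increment is exactly `Φ(r')* [B, V] Φ(r)`, and `V` is `i` times the weak
  -- integral of `Λ s Φ s Φ(r)*`.
  set V := (Φ r' - Φ r) * star (Φ r) with hV
  have e1 : star (Φ r') * B * Φ r' - star (Φ r) * B * Φ r =
      star (Φ r') * (B * V - V * B) * Φ r := by
    have : star (Φ r') * (B * V - V * B) * Φ r =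
      star (Φ r') * B * Φ r' * (star (Φ r) * Φ r) - star (Φ r') * B * Φ r * (star (Φ r) * Φ r)
        - (star (Φ r') * Φ r') * star (Φ r) * B * Φ r
        + star (Φ r') * (Φ r * star (Φ r)) * B * Φ r := by
      rw [hV]; noncomm_ring
    rw [this, hΦ1, hΦ1, hΦ2]
    noncomm_ring
  rw [e1]
  have e2 : ‖star (Φ r') * (B * V - V * B) * Φ r‖ ≤ ‖B * V - V * B‖ := by
    refine (norm_mul_le _ _).trans ((mul_le_of_le_one_right (norm_nonneg _) (hΦn r)).trans ?_)
    exact (norm_mul_le _ _).trans (mul_le_of_le_one_left (norm_nonneg _) (hΦs r'))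
  refine e2.trans (norm_le_of_norm_inner_le _ (by positivity) fun φ ψ => ?_)
  set K : ℝ → H →L[ℂ] H := fun s => B * (Λ s * Φ s * star (Φ r)) - Λ s * Φ s * star (Φ r) * B
    with hK
  have hKn : ∀ s ∈ Set.uIoc r r', ‖K s‖ ≤ b s + 2 * C ^ 2 * |r' - r| := fun s hs => by
    have hs' := Set.uIoc_subset_uIcc hs
    -- `Y` is the error made by replacing `Φ s` with `Φ r`; the Lipschitz bound gives `C² |r' - r|`,
    -- and its commutator with `B` at most doubles this.
    set Y := Λ s * (Φ s - Φ r) * star (Φ r) with hY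
    have h1 : K s = (B * Λ s - Λ s * B) + (B * Y - Y * B) := by
      have : K s = B * Λ s * (Φ r * star (Φ r)) - Λ s * (Φ r * star (Φ r)) * B
          + (B * Y - Y * B) := by
        rw [hK, hY]; noncomm_ring
      rw [this, hΦ2, mul_one, mul_one]
    have hYn : ‖Y‖ ≤ C ^ 2 * |r' - r| := by
      have h2 : ‖Φ s - Φ r‖ ≤ C * |r' - r| :=
        (h.norm_sub_le hΦ hΛ r s).trans (mul_le_mul_of_nonneg_left
          (Set.abs_sub_left_of_mem_uIcc hs') hC)
      calc ‖Y‖ ≤ ‖Λ s * (Φ s - Φ r)‖ * ‖star (Φ r)‖ := norm_mul_le _ _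
        _ ≤ ‖Λ s * (Φ s - Φ r)‖ := mul_le_of_le_one_right (norm_nonneg _) (hΦs r)
        _ ≤ ‖Λ s‖ * ‖Φ s - Φ r‖ := norm_mul_le _ _
        _ ≤ C * (C * |r' - r|) := mul_le_mul (hΛ s) h2 (norm_nonneg _) hC
        _ = _ := by ring
    have h3 : ‖B * Y‖ ≤ ‖Y‖ :=
      (norm_mul_le _ _).trans (mul_le_of_le_one_left (norm_nonneg _) hB)
    have h4 : ‖Y * B‖ ≤ ‖Y‖ :=
      (norm_mul_le _ _).trans (mul_le_of_le_one_right (norm_nonneg _) hB)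
    rw [h1]
    have h5 := norm_add_le (B * Λ s - Λ s * B) (B * Y - Y * B)
    have h6 := _root_.norm_sub_le (B * Y) (Y * B)
    have h7 := hbΛ s hs'
    linarith
  have e3 : ⟪φ, (B * V - V * B) ψ⟫_ℂ = Complex.I * ∫ s in r..r', ⟪φ, K s ψ⟫_ℂ := by
    have i1 := h.intervalIntegrable r r' (star B φ) (star (Φ r) ψ)
    have i2 := h.intervalIntegrable r r' φ (star (Φ r) (B ψ))
    have hst : ∀ A : H →L[ℂ] H, ⟪φ, B (A ψ)⟫_ℂ = ⟪star B φ, A ψ⟫_ℂ := fun A => by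
      rw [ContinuousLinearMap.star_eq_adjoint, ContinuousLinearMap.adjoint_inner_left]
    have h1 : ∀ s, ⟪φ, K s ψ⟫_ℂ = ⟪star B φ, (Λ s * Φ s) (star (Φ r) ψ)⟫_ℂ -
        ⟪φ, (Λ s * Φ s) (star (Φ r) (B ψ))⟫_ℂ := fun s => by
      rw [hK]
      simp only [sub_apply, _root_.inner_sub_right]
      congr 1
      exact hst (Λ s * Φ s * star (Φ r))
    simp_rw [h1]
    rw [intervalIntegral.integral_sub i1 i2, mul_sub, ← h.inner_sub, ← h.inner_sub,
      sub_apply, _root_.inner_sub_right]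
    congr 1
    exact hst V
  rw [e3, norm_mul, Complex.norm_I, one_mul]
  have hg : Continuous fun s => (b s + 2 * C ^ 2 * |r' - r|) * (‖φ‖ * ‖ψ‖) := by fun_prop
  refine (intervalIntegral.norm_integral_le_abs_of_norm_le
    (g := fun s => (b s + 2 * C ^ 2 * |r' - r|) * (‖φ‖ * ‖ψ‖)) ?_
    (hg.intervalIntegrable _ _)).trans ?_
  · refine (ae_restrict_iff' measurableSet_uIoc).2 (Filter.Eventually.of_forall fun s hs => ?_)
    calc ‖⟪φ, K s ψ⟫_ℂ‖ ≤ ‖φ‖ * ‖K s ψ‖ := norm_inner_le_norm _ _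
      _ ≤ ‖φ‖ * ((b s + 2 * C ^ 2 * |r' - r|) * ‖ψ‖) := by
          gcongr
          exact (ContinuousLinearMap.le_opNorm _ _).trans (by gcongr; exact hKn s hs)
      _ = _ := by ring
  · rw [intervalIntegral.integral_mul_const, abs_mul, abs_of_nonneg (by positivity : 0 ≤ ‖φ‖ * ‖ψ‖),
      mul_assoc _ ‖φ‖ ‖ψ‖, intervalIntegral.integral_add (hb.intervalIntegrable _ _)
        intervalIntegrable_const, intervalIntegral.integral_const, smul_eq_mul]
    gcongr
    refine (abs_add_le _ _).trans (add_le_add le_rfl (le_of_eq ?_))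
    rw [abs_mul, abs_of_nonneg (by positivity : 0 ≤ 2 * C ^ 2 * |r' - r|)]
    ring

/-- Multiplying by a unitary preserves the norm. In the conjugated form, commutators at different
times can be compared through increments of `Φ* B Φ`. -/
lemma norm_commutator_eq_norm_conj_sub {U : H →L[ℂ] H} (hU : U ∈ unitary (H →L[ℂ] H)) :
    ‖U * B - B * U‖ = ‖star U * B * U - B‖ := by
  obtain ⟨h1, h2⟩ := Unitary.mem_iff.1 hU
  have : star U * B * U - B = -(star U * (U * B - B * U)) := by
    rw [mul_sub, ← mul_assoc, h1]; noncomm_ring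
  rw [this, norm_neg]
  refine le_antisymm ?_ ((norm_mul_le _ _).trans (mul_le_of_le_one_left (norm_nonneg _)
    ((norm_star _).trans_le (norm_le_one_of_mem_unitary hU))))
  calc ‖U * B - B * U‖ = ‖U * (star U * (U * B - B * U))‖ := by rw [← mul_assoc, h2, one_mul]
    _ ≤ _ := (norm_mul_le _ _).trans (mul_le_of_le_one_left (norm_nonneg _)
      (norm_le_one_of_mem_unitary hU))

/-- If `Φ` is unitary and `Φ' = i Λ Φ` weakly, then the growth of `[Φ, B]` is controlled by
`[Λ, B]`. -/
lemma IsWeakSolution.norm_commutator_le (h : IsWeakSolution Φ Λ)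
    (hΦ : ∀ s, Φ s ∈ unitary (H →L[ℂ] H)) (hΛ : ∀ s, ‖Λ s‖ ≤ C) (hB : ‖B‖ ≤ 1) {b : ℝ → ℝ}
    (hb : Continuous b) (hb0 : ∀ s, 0 ≤ s → 0 ≤ b s) (t : ℝ)
    (hbΛ : ∀ s, |s| ≤ |t| → |t - s| + |s| = |t| → ‖Λ s * B - B * Λ s‖ ≤ b |s|) :
    ‖Φ t * B - B * Φ t‖ ≤ ‖Φ 0 * B - B * Φ 0‖ + ∫ s in (0 : ℝ)..|t|, b s := by
  rw [norm_commutator_eq_norm_conj_sub (hΦ t), norm_commutator_eq_norm_conj_sub (hΦ 0)]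
  suffices hq : ‖star (Φ t) * B * Φ t - star (Φ 0) * B * Φ 0‖ ≤ ∫ s in (0 : ℝ)..|t|, b s by
    have := norm_sub_le_norm_sub_add_norm_sub (star (Φ t) * B * Φ t) (star (Φ 0) * B * Φ 0) B
    linarith
  have hint : ∀ x y, IntervalIntegrable b volume x y := fun x y => hb.intervalIntegrable x y
  -- Running from `0` to `t` as `t * x` with `0 ≤ x ≤ 1` treats both signs of `t` at once; the
  -- factor `|t| ^ 2` is the rescaled quadratic error.
  have key := norm_sub_le_of_second_order (fun r => star (Φ r) * B * Φ r)
    (fun x => ∫ s in (0 : ℝ)..|t| * x, b s) (2 * C ^ 2 * |t| ^ 2) t ?_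
  · simpa using key
  intro x y hx hxy hy
  have h1 := h.norm_conj_sub_le hΦ hΛ hB (b := fun s => b |s|) (by fun_prop) (t * x) (t * y) ?_
  · refine h1.trans (add_le_add (le_of_eq ?_) (le_of_eq ?_))
    · rw [intervalIntegral.integral_interval_sub_left (hint _ _) (hint _ _)]
      rcases le_total 0 t with ht | ht
      · rw [abs_of_nonneg ht, abs_of_nonneg (intervalIntegral.integral_nonneg (by gcongr)
          fun s _ => hb0 _ (abs_nonneg _))]
        refine intervalIntegral.integral_congr fun s hs => ?_
        rw [Set.uIcc_of_le (by gcongr)] at hs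
        simp only [abs_of_nonneg ((mul_nonneg ht hx).trans hs.1)]
      · have hle : t * y ≤ t * x := mul_le_mul_of_nonpos_left hxy ht
        rw [abs_of_nonpos ht, intervalIntegral.integral_symm, abs_neg,
          abs_of_nonneg (intervalIntegral.integral_nonneg hle fun s _ => hb0 _ (abs_nonneg _))]
        rw [neg_mul, neg_mul, ← intervalIntegral.integral_comp_neg]
        refine intervalIntegral.integral_congr fun s hs => ?_
        rw [Set.uIcc_of_le hle] at hs
        simp only [abs_of_nonpos (hs.2.trans (mul_nonpos_of_nonpos_of_nonneg ht hx))]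
    · rw [← mul_sub, abs_mul, abs_of_nonneg (sub_nonneg.2 hxy)]
      ring
  · intro s hs
    rw [norm_sub_rev]
    rcases le_total 0 t with ht | ht
    · rw [Set.uIcc_of_le (by gcongr)] at hs
      have h0 : 0 ≤ s := (mul_nonneg ht hx).trans hs.1
      have h2 : s ≤ t := hs.2.trans (mul_le_of_le_one_right ht hy)
      refine hbΛ s ?_ ?_
      · rwa [abs_of_nonneg h0, abs_of_nonneg ht]
      · rw [abs_of_nonneg h0, abs_of_nonneg ht, abs_of_nonneg (sub_nonneg.2 h2)]
        ring
    · rw [Set.uIcc_of_ge (mul_le_mul_of_nonpos_left hxy ht)] at hs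
      have h0 : s ≤ 0 := hs.2.trans (mul_nonpos_of_nonpos_of_nonneg ht hx)
      have h2 : t ≤ s := by nlinarith [hs.1]
      refine hbΛ s ?_ ?_
      · rw [abs_of_nonpos h0, abs_of_nonpos ht]; linarith
      · rw [abs_of_nonpos h0, abs_of_nonpos ht, abs_of_nonpos (sub_nonpos.2 h2)]
        ring

end Interpolation

/-! ### Weak integrals -/

section WeakIntegral

variable {H : Type*} [NormedAddCommGroup H] [InnerProductSpace ℂ H]
  {Z : Type*} [MeasurableSpace Z] {μ : SignedMeasure Z}

lemma integrable_posPart_of_totalVariation {u : Z → ℂ} (h : Integrable u μ.totalVariation) :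
    Integrable u μ.toJordanDecomposition.posPart :=
  (integrable_add_measure.1 h).1

lemma integrable_negPart_of_totalVariation {u : Z → ℂ} (h : Integrable u μ.totalVariation) :
    Integrable u μ.toJordanDecomposition.negPart :=
  (integrable_add_measure.1 h).2

lemma signedIntegral_sub {u w : Z → ℂ} (hu : Integrable u μ.totalVariation)
    (hw : Integrable w μ.totalVariation) :
    signedIntegral μ (fun z => u z - w z) = signedIntegral μ u - signedIntegral μ w := by
  rw [signedIntegral, signedIntegral, signedIntegral,
    integral_sub (integrable_posPart_of_totalVariation hu) (integrable_posPart_of_totalVariation hw),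
    integral_sub (integrable_negPart_of_totalVariation hu) (integrable_negPart_of_totalVariation hw)]
  ring

lemma enorm_signedIntegral_le (u : Z → ℂ) :
    ‖signedIntegral μ u‖ₑ ≤ ∫⁻ z, ‖u z‖ₑ ∂μ.totalVariation := by
  rw [signedIntegral, SignedMeasure.totalVariation, lintegral_add_measure]
  exact (enorm_sub_le).trans (add_le_add (enorm_integral_le_lintegral_enorm _)
    (enorm_integral_le_lintegral_enorm _))

variable {G G' : Z → H →L[ℂ] H} {Q Q' : H →L[ℂ] H}

lemma IsWeakIntegral.sub (h : IsWeakIntegral μ G Q) (h' : IsWeakIntegral μ G' Q') :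
    IsWeakIntegral μ (fun z => G z - G' z) (Q - Q') := fun φ ψ => by
  simp only [sub_apply, inner_sub_right]
  exact ⟨(h φ ψ).1.sub (h' φ ψ).1, by
    rw [signedIntegral_sub (h φ ψ).1 (h' φ ψ).1, (h φ ψ).2, (h' φ ψ).2]⟩

lemma IsWeakIntegral.mul_right (h : IsWeakIntegral μ G Q) (A : H →L[ℂ] H) :
    IsWeakIntegral μ (fun z => G z * A) (Q * A) := fun φ ψ => h φ (A ψ)

lemma IsWeakIntegral.mul_left [CompleteSpace H] (h : IsWeakIntegral μ G Q) (A : H →L[ℂ] H) :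
    IsWeakIntegral μ (fun z => A * G z) (A * Q) := fun φ ψ => by
  have hA : ∀ R : H →L[ℂ] H, ⟪φ, (A * R) ψ⟫_ℂ = ⟪star A φ, R ψ⟫_ℂ := fun R => by
    rw [ContinuousLinearMap.star_eq_adjoint, ContinuousLinearMap.adjoint_inner_left]
    rfl
  simp_rw [hA]
  exact h (star A φ) ψ

lemma enorm_le_of_enorm_inner_le (A : H →L[ℂ] H) {C : ℝ≥0∞}
    (h : ∀ φ ψ : H, ‖⟪φ, A ψ⟫_ℂ‖ₑ ≤ C * ‖φ‖ₑ * ‖ψ‖ₑ) : ‖A‖ₑ ≤ C := by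
  rcases eq_or_ne C ⊤ with rfl | hC
  · exact le_top
  rw [← ofReal_norm]
  refine ENNReal.ofReal_le_of_le_toReal (norm_le_of_norm_inner_le A ENNReal.toReal_nonneg
    fun φ ψ => ?_)
  have := ENNReal.toReal_mono (by finiteness) (h φ ψ)
  simpa [ENNReal.toReal_mul] using this

/-- Weak integrability concerns matrix elements only, so the bound is taken there first and then
over all vectors; neither `‖G z‖ₑ` nor `k` has to be measurable. -/
lemma IsWeakIntegral.enorm_le (h : IsWeakIntegral μ G Q) {k : Z → ℝ≥0∞}
    (hk : ∀ᵐ z ∂μ.totalVariation, ‖G z‖ₑ ≤ k z) : ‖Q‖ₑ ≤ ∫⁻ z, k z ∂μ.totalVariation := by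
  refine enorm_le_of_enorm_inner_le _ fun φ ψ => ?_
  rw [(h φ ψ).2]
  refine (enorm_signedIntegral_le _).trans ?_
  rw [mul_assoc, ← lintegral_mul_const' _ _ (by finiteness)]
  refine lintegral_mono_ae (hk.mono fun z hz => ?_)
  have h1 : ‖⟪φ, G z ψ⟫_ℂ‖ₑ ≤ ‖φ‖ₑ * ‖G z ψ‖ₑ := by
    rw [← ofReal_norm, ← ofReal_norm, ← ofReal_norm,
      ← ENNReal.ofReal_mul (norm_nonneg _)]
    exact ENNReal.ofReal_le_ofReal (norm_inner_le_norm _ _)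
  calc _ ≤ ‖φ‖ₑ * ‖G z ψ‖ₑ := h1
    _ ≤ ‖φ‖ₑ * (‖G z‖ₑ * ‖ψ‖ₑ) := by gcongr; exact (G z).le_opENorm ψ
    _ ≤ ‖φ‖ₑ * (k z * ‖ψ‖ₑ) := by gcongr
    _ = _ := by ring

/-- Square-summability dominates the series uniformly in `z`, and the measure is finite, so sum and
integral may be exchanged. Hence σ-weakly continuous functionals pass through weak integrals. -/
lemma IsWeakIntegral.hasSum_inner (h : IsWeakIntegral μ G Q) {C : ℝ} (hG : ∀ z, ‖G z‖ ≤ C)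
    {ξ η : ℕ → H} (hξ : Summable fun n => ‖ξ n‖ ^ 2) (hη : Summable fun n => ‖η n‖ ^ 2)
    {u : Z → ℂ} (hu : ∀ z, HasSum (fun n => ⟪ξ n, G z (η n)⟫_ℂ) (u z)) :
    Integrable u μ.totalVariation ∧
      HasSum (fun n => ⟪ξ n, Q (η n)⟫_ℂ) (signedIntegral μ u) := by
  have hfin : IsFiniteMeasure μ.totalVariation := by
    rw [SignedMeasure.totalVariation]; infer_instance
  have hsum : Summable fun n => C * (‖ξ n‖ ^ 2 + ‖η n‖ ^ 2) := (hξ.add hη).mul_left C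
  have hbd : ∀ n z, ‖⟪ξ n, G z (η n)⟫_ℂ‖ ≤ C * (‖ξ n‖ ^ 2 + ‖η n‖ ^ 2) := fun n z => by
    have hC : 0 ≤ C := (norm_nonneg _).trans (hG z)
    calc _ ≤ ‖ξ n‖ * ‖G z (η n)‖ := norm_inner_le_norm _ _
      _ ≤ ‖ξ n‖ * (C * ‖η n‖) := by
          gcongr
          exact ((G z).le_opNorm _).trans (by gcongr; exact hG z)
      _ = C * (‖ξ n‖ * ‖η n‖) := by ring
      _ ≤ _ := by
          gcongr
          nlinarith [sq_nonneg (‖ξ n‖ - ‖η n‖), sq_nonneg ‖ξ n‖, sq_nonneg ‖η n‖]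
  have hint : ∀ n, Integrable (fun z => ⟪ξ n, G z (η n)⟫_ℂ) μ.totalVariation :=
    fun n => (h _ _).1
  have hui : Integrable u μ.totalVariation := by
    refine Integrable.of_bound (C := ∑' n, C * (‖ξ n‖ ^ 2 + ‖η n‖ ^ 2)) ?_ ?_
    -- Measurability of `u` is inherited from the finite partial sums.
    · refine aestronglyMeasurable_of_tendsto_ae Filter.atTop
        (f := fun (N : Finset ℕ) z => ∑ n ∈ N, ⟪ξ n, G z (η n)⟫_ℂ) (fun N => ?_)
        (Filter.Eventually.of_forall fun z => hu z)
      exact Finset.aestronglyMeasurable_fun_sum _ fun n _ => (hint n).1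
    · exact Filter.Eventually.of_forall fun z => by
        rw [← (hu z).tsum_eq]
        exact tsum_of_norm_bounded hsum.hasSum fun n => hbd n z
  have key : ∀ ν : Measure Z, [IsFiniteMeasure ν] →
      (∀ n, Integrable (fun z => ⟪ξ n, G z (η n)⟫_ℂ) ν) →
      HasSum (fun n => ∫ z, ⟪ξ n, G z (η n)⟫_ℂ ∂ν) (∫ z, u z ∂ν) := fun ν _ hν => by
    have := hasSum_integral_of_summable_integral_norm hν ?_
    · simpa only [(hu _).tsum_eq] using this
    · refine Summable.of_nonneg_of_le (fun n => integral_nonneg fun z => norm_nonneg _)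
        (fun n => ?_) (hsum.mul_right (ν.real Set.univ))
      have := norm_integral_le_of_norm_le_const (μ := ν)
        (f := fun z => ‖⟪ξ n, G z (η n)⟫_ℂ‖) (C := C * (‖ξ n‖ ^ 2 + ‖η n‖ ^ 2))
        (Filter.Eventually.of_forall fun z => by rw [norm_norm]; exact hbd n z)
      exact (le_abs_self _).trans this
  refine ⟨hui, ?_⟩
  simp_rw [(h _ _).2]
  exact (key _ fun n => integrable_posPart_of_totalVariation (hint n)).sub
    (key _ fun n => integrable_negPart_of_totalVariation (hint n))

/-- Normality of `β.evol s` is what lets the perturbed evolution be moved under the integral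
defining the interaction. -/
lemma IsWeakIntegral.evol [CompleteSpace H] {M : StarSubalgebra ℂ (H →L[ℂ] H)}
    (β : WStarDynamics M) (s : ℝ) {G : Z → M} {Q : M}
    (h : IsWeakIntegral μ (fun z => (G z : H →L[ℂ] H)) Q) {C : ℝ} (hG : ∀ z, ‖G z‖ ≤ C) :
    IsWeakIntegral μ (fun z => (β.evol s (G z) : H →L[ℂ] H)) (β.evol s Q) := fun φ ψ => by
  obtain ⟨ξ, η, hξ, hη, hsum⟩ := β.normal s φ ψ
  obtain ⟨h1, h2⟩ := h.hasSum_inner hG hξ hη fun z => hsum (G z)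
  exact ⟨h1, (hsum Q).unique h2⟩

end WeakIntegral

/-! ### Moments of the interaction measures -/

section Moments

variable {Γ : Type*} (μ : ∀ X : Finset Γ, SignedMeasure (X → ℂ))

instance (X : Finset Γ) : IsFiniteMeasure (μ X).totalVariation := by
  rw [SignedMeasure.totalVariation]; infer_instance

lemma sum_lintegral_mul_le_pairMoment (Λ : Finset Γ) (A A' : Γ → ℝ≥0∞) :
    ∑ X ∈ Λ.powerset, ∫⁻ z : X → ℂ, (∑ x : X, A x * ‖z x‖ₑ) * (∑ y : X, A' y * ‖z y‖ₑ)
      ∂(μ X).totalVariation ≤ ∑' x, ∑' y, A x * pairMoment μ x y * A' y := by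
  classical
  -- Extending by zero to sets not containing both sites makes all sums run over fixed index types,
  -- so they can be interchanged.
  let m : Γ → Γ → Finset Γ → ℝ≥0∞ := fun x y X =>
    if h : x ∈ X ∧ y ∈ X then ∫⁻ z : X → ℂ, ‖z ⟨x, h.1⟩‖ₑ * ‖z ⟨y, h.2⟩‖ₑ ∂(μ X).totalVariation
    else 0
  have hm : ∀ x y, pairMoment μ x y = ∑' X, m x y X := fun x y => by
    have h0 : Function.support (m x y) ⊆ {X | x ∈ X ∧ y ∈ X} := fun X hX => by
      by_contra h
      exact hX (dif_neg h)
    rw [← tsum_subtype_eq_of_support_subset h0, pairMoment]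
    exact tsum_congr fun X => by
      rw [show m x y X = _ from dif_pos (show x ∈ X.1 ∧ y ∈ X.1 from X.2)]
  have hX : ∀ X : Finset Γ, ∫⁻ z : X → ℂ, (∑ x : X, A x * ‖z x‖ₑ) * (∑ y : X, A' y * ‖z y‖ₑ)
      ∂(μ X).totalVariation = ∑' x, ∑' y, A x * m x y X * A' y := fun X => by
    have h1 : ∀ z : X → ℂ, (∑ x : X, A x * ‖z x‖ₑ) * (∑ y : X, A' y * ‖z y‖ₑ) =
        ∑ x : X, ∑ y : X, A x * A' y * (‖z x‖ₑ * ‖z y‖ₑ) := fun z => by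
      rw [Finset.sum_mul_sum]
      exact Finset.sum_congr rfl fun x _ => Finset.sum_congr rfl fun y _ => by ring
    simp_rw [h1]
    rw [lintegral_finsetSum _ fun x _ => by fun_prop]
    have h2 : ∀ x : X, ∫⁻ z : X → ℂ, ∑ y : X, A x * A' y * (‖z x‖ₑ * ‖z y‖ₑ)
        ∂(μ X).totalVariation = ∑ y : X, A x * m x y X * A' y := fun x => by
      rw [lintegral_finsetSum _ fun y _ => by fun_prop]
      refine Finset.sum_congr rfl fun y _ => ?_
      rw [lintegral_const_mul _ (by fun_prop)]
      have : m x y X = ∫⁻ z : X → ℂ, ‖z x‖ₑ * ‖z y‖ₑ ∂(μ X).totalVariation :=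
        dif_pos (⟨x.2, y.2⟩ : (x : Γ) ∈ X ∧ (y : Γ) ∈ X)
      rw [this]; ring
    simp_rw [h2]
    rw [tsum_eq_sum (s := X), ← Finset.sum_coe_sort X]
    · refine Finset.sum_congr rfl fun x _ => ?_
      rw [tsum_eq_sum (s := X), ← Finset.sum_coe_sort X]
      intro y hy
      simp [m, hy]
    · intro x hx
      simp [m, hx]
  simp_rw [hX, hm, ← ENNReal.tsum_mul_left, ← ENNReal.tsum_mul_right]
  -- Subsets of `Λ` are enlarged to all finite sets here, which makes the bound uniform in `Λ`.
  refine (ENNReal.sum_le_tsum _).trans (le_of_eq ?_)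
  rw [ENNReal.tsum_comm]
  exact tsum_congr fun x => ENNReal.tsum_comm

/-- The sum of the first moments of the measures `μ_X` with `X ⊆ Λ`. -/
def firstMoment (Λ : Finset Γ) : ℝ≥0∞ :=
  ∑ X ∈ Λ.powerset, ∑ x : X, ∫⁻ z : X → ℂ, ‖z x‖ₑ ∂(μ X).totalVariation

/-- Since `r ≤ 1 + r²` and each measure is finite, the diagonal second moments suffice. Only
finiteness matters: this quantity enters just the remainder of the iteration. -/
lemma firstMoment_lt_top (hμ : ∀ x y, pairMoment μ x y < ⊤) (Λ : Finset Γ) :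
    firstMoment μ Λ < ⊤ := by
  refine ENNReal.sum_lt_top.2 fun X _ => ENNReal.sum_lt_top.2 fun x _ => ?_
  calc ∫⁻ z : X → ℂ, ‖z x‖ₑ ∂(μ X).totalVariation
      ≤ ∫⁻ z : X → ℂ, (1 + ‖z x‖ₑ * ‖z x‖ₑ) ∂(μ X).totalVariation := by
        refine lintegral_mono fun z => ?_
        rcases le_total ‖z x‖ₑ 1 with h | h
        · exact h.trans le_self_add
        · exact (le_mul_of_one_le_left zero_le h).trans le_add_self
    _ = (μ X).totalVariation Set.univ +
        ∫⁻ z : X → ℂ, ‖z x‖ₑ * ‖z x‖ₑ ∂(μ X).totalVariation := by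
        rw [lintegral_add_left (by fun_prop), lintegral_one]
    _ < ⊤ := by
        refine ENNReal.add_lt_top.2 ⟨measure_lt_top _ _, lt_of_le_of_lt ?_ (hμ x x)⟩
        exact ENNReal.le_tsum (f := fun Y : {Y : Finset Γ // (x : Γ) ∈ Y ∧ (x : Γ) ∈ Y} =>
          ∫⁻ z : Y.1 → ℂ, ‖z ⟨x, Y.2.1⟩‖ₑ * ‖z ⟨x, Y.2.2⟩‖ₑ ∂(μ Y.1).totalVariation)
          ⟨X, x.2, x.2⟩

lemma sum_lintegral_le_firstMoment (Λ : Finset Γ) (A : Γ → ℝ≥0∞) :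
    ∑ X ∈ Λ.powerset, ∫⁻ z : X → ℂ, ∑ x : X, A x * ‖z x‖ₑ ∂(μ X).totalVariation ≤
      firstMoment μ Λ * ∑ x ∈ Λ, A x := by
  rw [firstMoment, Finset.sum_mul]
  refine Finset.sum_le_sum fun X hX => ?_
  rw [lintegral_finsetSum _ fun x _ => by fun_prop, Finset.sum_mul]
  refine Finset.sum_le_sum fun x _ => ?_
  rw [lintegral_const_mul _ (by fun_prop), mul_comm]
  gcongr
  exact Finset.single_le_sum (f := A) (fun _ _ => zero_le) (Finset.mem_powerset.1 hX x.2)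

end Moments

/-! ### Represented Weyl operators -/

section Dynamics

variable {H : Type*} [NormedAddCommGroup H] [InnerProductSpace ℂ H] [CompleteSpace H]

lemma isClosed_weakClosure (S : StarSubalgebra ℂ (H →L[ℂ] H)) :
    IsClosed (weakClosure S : Set (H →L[ℂ] H)) :=
  (StarSubalgebra.isClosed_topologicalClosure (S.map (toWOT H))).preimage
    ContinuousLinearMapWOT.continuous_ofCLM

/-- Norm closedness makes `M` a C⋆-algebra, and ⋆-homomorphisms of C⋆-algebras are contractive. -/
lemma WStarDynamics.norm_evol_le {M : StarSubalgebra ℂ (H →L[ℂ] H)} (hM : IsClosed (M : Set (H →L[ℂ] H)))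
    (β : WStarDynamics M) (s : ℝ) (A : M) : ‖β.evol s A‖ ≤ ‖A‖ :=
  NonUnitalStarAlgHom.norm_apply_le (β.evol s) A

variable {D : Type*} [AddCommGroup D] [Module ℝ D] {σ : D →ₗ[ℝ] D →ₗ[ℝ] ℝ}
  {M : StarSubalgebra ℂ (H →L[ℂ] H)} {W : D → M}

/-- A family of operators in `M` satisfying the Weyl relations over `(D, σ)`. -/
structure IsWeylSystem (σ : D →ₗ[ℝ] D →ₗ[ℝ] ℝ) (W : D → M) : Prop where
  skew : ∀ f g, σ f g = -σ g f
  zero : W 0 = 1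
  star_eq : ∀ f, star (W f) = W (-f)
  mul : ∀ f g, W f * W g = weylPhase σ f g • W (f + g)

namespace IsWeylSystem

variable (hW : IsWeylSystem σ W)
include hW

lemma self_eq_zero (f : D) : σ f f = 0 := by
  have := hW.skew f f
  linarith

lemma mul_neg (f : D) : W f * W (-f) = 1 := by
  rw [hW.mul, add_neg_cancel, hW.zero]
  simp [weylPhase, hW.self_eq_zero f]

lemma neg_mul (f : D) : W (-f) * W f = 1 := by
  simpa using hW.mul_neg (-f)

lemma evol_mem_unitary (β : WStarDynamics M) (s : ℝ) (f : D) :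
    (β.evol s (W f) : H →L[ℂ] H) ∈ unitary (H →L[ℂ] H) := by
  have h : ∀ A A' : M, A * A' = 1 →
      (β.evol s A : H →L[ℂ] H) * (β.evol s A' : H →L[ℂ] H) = 1 := fun A A' hA => by
    rw [← MulMemClass.coe_mul, ← map_mul, hA, map_one]
    rfl
  have hs : star (β.evol s (W f) : H →L[ℂ] H) = (β.evol s (W (-f)) : H →L[ℂ] H) := by
    rw [← hW.star_eq, map_star]
    rfl
  rw [Unitary.mem_iff, hs]
  exact ⟨h _ _ (hW.neg_mul f), h _ _ (hW.mul_neg f)⟩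

lemma mem_unitary (f : D) : (W f : H →L[ℂ] H) ∈ unitary (H →L[ℂ] H) := by
  have hs : star (W f : H →L[ℂ] H) = (W (-f) : H →L[ℂ] H) := congrArg Subtype.val (hW.star_eq f)
  rw [Unitary.mem_iff, hs]
  exact ⟨congrArg Subtype.val (hW.neg_mul f), congrArg Subtype.val (hW.mul_neg f)⟩

lemma norm_evol_le_one (β : WStarDynamics M) (s : ℝ) (f : D) : ‖β.evol s (W f)‖ ≤ 1 :=
  norm_le_one_of_mem_unitary (hW.evol_mem_unitary β s f)

lemma norm_le_one (f : D) : ‖W f‖ ≤ 1 :=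
  norm_le_one_of_mem_unitary (hW.mem_unitary f)

lemma norm_conj_le (f : D) (A : M) : ‖W f * A * W (-f)‖ ≤ ‖A‖ :=
  (norm_mul_le _ _).trans ((mul_le_of_le_one_right (norm_nonneg _) (hW.norm_le_one _)).trans
    ((norm_mul_le _ _).trans (mul_le_of_le_one_left (norm_nonneg _) (hW.norm_le_one _))))

lemma norm_sub_conj_le (f : D) (A : M) : ‖A - W f * A * W (-f)‖ ≤ 2 * ‖A‖ := by
  have := hW.norm_conj_le f A
  have := norm_sub_le A (W f * A * W (-f))
  linarith

/-- The two half phases of the Weyl relations combine to a full one. This scalar turns the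
difference of an interaction term and its conjugate into a quantity controlled by `1 - e^{iσ}`. -/
lemma sub_conj (h g : D) :
    W g - W h * W g * W (-h) = (1 - Complex.exp (-(Complex.I * (σ h g : ℂ)))) • W g := by
  have hph : weylPhase σ h g * weylPhase σ (h + g) (-h) =
      Complex.exp (-(Complex.I * (σ h g : ℂ))) := by
    rw [weylPhase, weylPhase, ← Complex.exp_add]
    congr 1
    rw [map_neg, map_add, LinearMap.add_apply, hW.self_eq_zero h, hW.skew g h]
    push_cast
    ring
  rw [hW.mul, smul_mul_assoc, hW.mul, smul_smul, hph, sub_smul, one_smul, add_neg_cancel_comm]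

end IsWeylSystem

lemma norm_one_sub_exp_neg (x : ℝ) : ‖1 - Complex.exp (-(Complex.I * (x : ℂ)))‖ =
    ‖1 - Complex.exp (Complex.I * (x : ℂ))‖ := by
  rw [← Complex.norm_conj (1 - Complex.exp (Complex.I * (x : ℂ))), map_sub, map_one,
    ← Complex.exp_conj, map_mul, Complex.conj_I, Complex.conj_ofReal, neg_mul]

namespace IsWeylSystem

variable (hW : IsWeylSystem σ W)
include hW

lemma norm_lie_le (f g : D) :
    ‖⁅W f, W g⁆‖ ≤ ‖1 - Complex.exp (Complex.I * (σ f g : ℂ))‖ := by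
  have h1 : ⁅W f, W g⁆ =
      -((W g - W f * W g * W (-f)) * W f) := by
    rw [sub_mul, mul_assoc _ (W (-f)), hW.neg_mul, mul_one, Ring.lie_def]
    noncomm_ring
  rw [h1, norm_neg, hW.sub_conj]
  calc _ ≤ ‖(1 - Complex.exp (-(Complex.I * (σ f g : ℂ)))) • W g‖ * ‖W f‖ :=
        norm_mul_le _ _
    _ ≤ ‖(1 - Complex.exp (-(Complex.I * (σ f g : ℂ)))) • W g‖ :=
        mul_le_of_le_one_right (norm_nonneg _) (hW.norm_le_one f)
    _ ≤ ‖1 - Complex.exp (-(Complex.I * (σ f g : ℂ)))‖ * ‖W g‖ := norm_smul_le _ _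
    _ ≤ ‖1 - Complex.exp (-(Complex.I * (σ f g : ℂ)))‖ :=
        mul_le_of_le_one_right (norm_nonneg _) (hW.norm_le_one g)
    _ = _ := norm_one_sub_exp_neg _

lemma norm_lie_evol_le_two 
    (β : WStarDynamics (M)) (s : ℝ) (f g : D) :
    ‖⁅β.evol s (W f), W g⁆‖ ≤ 2 := by
  have h1 := hW.norm_evol_le_one β s f
  have h2 := hW.norm_le_one g
  rw [Ring.lie_def]
  refine (norm_sub_le _ _).trans ?_
  have h3 := norm_mul_le (β.evol s (W f)) (W g)
  have h4 := norm_mul_le (W g) (β.evol s (W f))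
  have h5 := mul_le_one₀ h1 (norm_nonneg _) h2
  have h6 := mul_le_one₀ h2 (norm_nonneg _) h1
  linarith

/-- The bound on `[β_t(W(f)), W(g)]` for a perturbation `β` of the quasifree dynamics `α` in terms
of a bound on the commutators of `W(g)` with the generators in the interaction picture. -/
lemma norm_lie_perturbed_le (hM : IsClosed (M : Set (H →L[ℂ] H))) 
    {T : ℝ → (D →ₗ[ℝ] D)} (hT_zero : T 0 = LinearMap.id)
    (hT_add : ∀ s t, T (s + t) = T s ∘ₗ T t) {α β : WStarDynamics (M)}
    (hα : ∀ t f, α.evol t (W f) = W (T t f)) {P : M}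
    (hβ : IsPerturbedDynamics α P β) (t : ℝ) (f g : D) {b : ℝ → ℝ} (hb : Continuous b)
    (hb0 : ∀ s, 0 ≤ s → 0 ≤ b s)
    (hbP : ∀ s, |s| ≤ |t| → |t - s| + |s| = |t| →
      ‖⁅β.evol s (P - W (T (t - s) f) * P * W (-T (t - s) f)), W g⁆‖ ≤
        b |s|) :
    ‖⁅β.evol t (W f), W g⁆‖ ≤
      ‖1 - Complex.exp (Complex.I * (σ (T t f) g : ℂ))‖ + ∫ s in (0 : ℝ)..|t|, b s := by
  -- Interaction picture: the harmonic evolution is undone while the perturbed one is switched on.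
  set Φ : ℝ → H →L[ℂ] H := fun s => β.evol s (W (T (t - s) f)) with hΦ
  set L : ℝ → H →L[ℂ] H := fun s =>
    β.evol s (P - W (T (t - s) f) * P * W (-T (t - s) f)) with hL
  -- From `[P, W] = (P - W P W*) W`, the commutator factors through `Φ`, so the equation becomes
  -- linear in `Φ` with generator `L`.
  have hLΦ : ∀ s, (β.evol s ⁅P, W (T (t - s) f)⁆ : H →L[ℂ] H) = L s * Φ s :=
    fun s => by
      rw [hL, hΦ, ← MulMemClass.coe_mul, ← map_mul, sub_mul,
        mul_assoc _ (W (-T (t - s) f)), hW.neg_mul, mul_one, Ring.lie_def]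
  have hsol : IsWeakSolution Φ L := fun r φ ψ => by
    -- At time `r` the integral equation is applied to `W (T (t - r) f)`; the group law makes the
    -- integrand `β_s([P, W(T_{t-s} f)])`, free of `r`.
    have h1 := hβ r (W (T (t - r) f)) φ ψ
    have h2 : ∀ s, α.evol (r - s) (W (T (t - r) f)) = W (T (t - s) f) :=
      fun s => by
        rw [hα, ← LinearMap.comp_apply, ← hT_add]
        congr 3
        ring
    have h3 : (Φ 0 : H →L[ℂ] H) = α.evol r (W (T (t - r) f)) := by
      have := h2 0
      rw [sub_zero] at this
      rw [this]
      exact congrArg Subtype.val (β.evol_zero _)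
    simp_rw [h2, hLΦ] at h1
    rw [h3]
    exact h1
  have hLn : ∀ s, ‖L s‖ ≤ 2 * ‖P‖ := fun s => by
    exact (β.norm_evol_le hM s _).trans (hW.norm_sub_conj_le _ _)
  have key := hsol.norm_commutator_le (B := (W g : H →L[ℂ] H))
    (fun s => hW.evol_mem_unitary β s _) hLn (hW.norm_le_one g) hb hb0 t hbP
  have ht : Φ t = β.evol t (W f) := by
    simp only [hΦ]
    rw [sub_self, hT_zero, LinearMap.id_apply]
  have h0 : Φ 0 = W (T t f) := by
    simp only [hΦ]
    rw [sub_zero]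
    exact congrArg Subtype.val (β.evol_zero _)
  rw [ht, h0] at key
  exact key.trans (add_le_add_left (hW.norm_lie_le _ _) _)

/-- Conjugation, the evolution and the commutator with `B` all pass under the weak integral; there
each Weyl operator only acquires a scalar factor. -/
lemma ofReal_norm_lie_evol_sub_conj_le {Z : Type*} [MeasurableSpace Z] {μ : SignedMeasure Z}
    {G : Z → M} {P : M} (hP : IsWeakIntegral μ (fun z => (G z : H →L[ℂ] H)) P)
    (hG : ∀ z, ‖G z‖ ≤ 1) (β : WStarDynamics M) (s : ℝ) (h : D) (B : M) {k : Z → ℝ≥0∞}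
    (hk : ∀ᵐ z ∂μ.totalVariation, ∃ g, G z = W g ∧
      ENNReal.ofReal (‖1 - Complex.exp (Complex.I * (σ h g : ℂ))‖ * ‖⁅β.evol s (W g), B⁆‖) ≤ k z) :
    ENNReal.ofReal ‖⁅β.evol s (P - W h * P * W (-h)), B⁆‖ ≤ ∫⁻ z, k z ∂μ.totalVariation := by
  have h1 : IsWeakIntegral μ (fun z => ((G z - W h * G z * W (-h) : M) : H →L[ℂ] H))
      ((P - W h * P * W (-h) : M) : H →L[ℂ] H) :=
    hP.sub ((hP.mul_left (W h : H →L[ℂ] H)).mul_right (W (-h) : H →L[ℂ] H))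
  have hbd : ∀ z, ‖G z - W h * G z * W (-h)‖ ≤ 2 := fun z =>
    (hW.norm_sub_conj_le h (G z)).trans (by linarith [hG z])
  have h2 := h1.evol β s hbd
  have h3 := (h2.mul_right (B : H →L[ℂ] H)).sub (h2.mul_left (B : H →L[ℂ] H))
  have h4 := h3.enorm_le (k := k) (hk.mono fun z hz => ?_)
  · rw [← ofReal_norm] at h4
    exact h4
  · obtain ⟨g, hg, hgk⟩ := hz
    rw [← ofReal_norm]
    refine le_trans (ENNReal.ofReal_le_ofReal ?_) hgk
    change ‖⁅β.evol s (G z - W h * G z * W (-h)), B⁆‖ ≤ _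
    rw [hg, hW.sub_conj, map_smul, Ring.lie_def, Ring.lie_def, smul_mul_assoc, mul_smul_comm,
      ← smul_sub, ← norm_one_sub_exp_neg]
    exact norm_smul_le _ _

end IsWeylSystem

end Dynamics

/-! ### The Weyl operators in the GNS representation -/

section GNS

variable {D : Type*} [AddCommGroup D] [Module ℝ D] {σ : D →ₗ[ℝ] D →ₗ[ℝ] ℝ}

lemma weyl_zero (σ : D →ₗ[ℝ] D →ₗ[ℝ] ℝ) : weyl σ 0 = 1 := by
  refine Subtype.ext (ContinuousLinearMap.ext fun ψ => lp.ext (funext fun k => ?_))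
  change weylPhase σ 0 k * ψ (k - 0) = ψ k
  simp [weylPhase]

lemma isWeylSystem_gnsRep (hσ : ∀ f g, σ f g = -σ g f) (ρ : CCRAlgebra σ →ₚ[ℂ] ℂ) :
    IsWeylSystem σ fun f => gnsRep ρ (weyl σ f) where
  skew := hσ
  zero := by
    refine Subtype.ext ?_
    change ρ.gnsStarAlgHom (weyl σ 0) = 1
    rw [weyl_zero, map_one]
  star_eq f := by
    refine Subtype.ext ?_
    change star (ρ.gnsStarAlgHom (weyl σ f)) = ρ.gnsStarAlgHom (weyl σ (-f))
    rw [← map_star, star_weyl σ hσ]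
  mul f g := by
    refine Subtype.ext ?_
    change ρ.gnsStarAlgHom (weyl σ f) * ρ.gnsStarAlgHom (weyl σ g) =
      weylPhase σ f g • ρ.gnsStarAlgHom (weyl σ (f + g))
    rw [← map_mul, weyl_mul σ hσ, map_smul]

end GNS

/-! ### Interaction integrands as elements of the von Neumann algebra -/

section Perturbation

variable {Γ : Type*} {D : Submodule ℝ (lp (fun _ : Γ => ℂ) 2)} {σ : D →ₗ[ℝ] D →ₗ[ℝ] ℝ}

lemma weylAt_mem (ρ : CCRAlgebra σ →ₚ[ℂ] ℂ) (X : Finset Γ) (z : X → ℂ) :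
    weylAt ρ X z ∈ gnsAlgebra ρ := by
  rw [weylAt]
  split_ifs with h
  · exact (gnsRep ρ (weyl σ ⟨deltaComb X z, h⟩)).2
  · exact zero_mem _

/-- The operator `weylAt ρ X z` as an element of the weak closure. -/
def gnsWeylAt (ρ : CCRAlgebra σ →ₚ[ℂ] ℂ) (X : Finset Γ) (z : X → ℂ) : gnsAlgebra ρ :=
  ⟨weylAt ρ X z, weylAt_mem ρ X z⟩

lemma gnsWeylAt_of_mem (ρ : CCRAlgebra σ →ₚ[ℂ] ℂ) {X : Finset Γ} {z : X → ℂ}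
    (h : deltaComb X z ∈ D) :
    gnsWeylAt ρ X z = gnsRep ρ (weyl σ ⟨deltaComb X z, h⟩) :=
  Subtype.ext (dif_pos h)

lemma norm_gnsWeylAt_le (hσ : ∀ f g, σ f g = -σ g f) (ρ : CCRAlgebra σ →ₚ[ℂ] ℂ) (X : Finset Γ)
    (z : X → ℂ) : ‖gnsWeylAt ρ X z‖ ≤ 1 := by
  change ‖weylAt ρ X z‖ ≤ 1
  rw [weylAt]
  split_ifs with h
  · exact (isWeylSystem_gnsRep hσ ρ).norm_le_one ⟨deltaComb X z, h⟩
  · exact norm_zero.trans_le zero_le_one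

end Perturbation

/-! ### The Lieb–Robinson bound for perturbed dynamics -/

section LiebRobinsonBound

variable {Γ : Type*} [MetricSpace Γ] {K : ℝ → ℝ}

/-- The integrand is the product of the pairings of `f` and of `g` with `z · δ_X`. The moment
condition links the two sites by a third kernel, and the triple convolution gives `κ C²`. -/
lemma sum_lintegral_smear_mul_smear_le (hK : IsDecayFunction Γ K)
    {μ : ∀ X : Finset Γ, SignedMeasure (X → ℂ)} {κ : ℝ} (hκ0 : 0 ≤ κ)
    (hκ : ∀ x y, pairMoment μ x y ≤ ENNReal.ofReal (κ * K (dist x y))) (Λ : Finset Γ)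
    (f g : lp (fun _ : Γ => ℂ) 2) :
    ∑ X ∈ Λ.powerset, ∫⁻ z : X → ℂ, (∑ x : X, smear K (fun x => ‖f x‖ₑ) x * ‖z x‖ₑ) *
      (∑ y : X, smear K (fun x => ‖g x‖ₑ) y * ‖z y‖ₑ) ∂(μ X).totalVariation ≤
      ENNReal.ofReal (κ * (convConst Γ K).toReal ^ 2 * pairSum K f g) := by
  refine (sum_lintegral_mul_le_pairMoment μ Λ _ _).trans ?_
  calc _ ≤ ∑' x, ∑' y, ENNReal.ofReal κ *
        (smear K (fun x => ‖f x‖ₑ) x * kern K x y * smear K (fun x => ‖g x‖ₑ) y) := by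
        refine ENNReal.tsum_le_tsum fun x => ENNReal.tsum_le_tsum fun y => ?_
        calc _ ≤ smear K (fun x => ‖f x‖ₑ) x * ENNReal.ofReal (κ * K (dist x y)) *
              smear K (fun x => ‖g x‖ₑ) y := by gcongr; exact hκ x y
          _ = _ := by rw [ENNReal.ofReal_mul hκ0, kern]; ring
    _ ≤ ENNReal.ofReal κ * (convConst Γ K ^ 2 *
        pairing K (fun x => ‖f x‖ₑ) (fun x => ‖g x‖ₑ)) := by
        simp_rw [ENNReal.tsum_mul_left]
        gcongr
        exact hK.tsum_smear_kern_smear_le _ _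
    _ = _ := by
        rw [← hK.ofReal_pairSum, mul_assoc, ENNReal.ofReal_mul hκ0,
          ENNReal.ofReal_mul (by positivity), ENNReal.ofReal_pow ENNReal.toReal_nonneg,
          ENNReal.ofReal_toReal hK.conv.ne]

/-- Pairing with the indicator function of `Λ` is just the sum of the smeared `f` over `Λ`, so this
crude bound has the same shape as the main term. -/
lemma sum_lintegral_smear_le (hK : IsDecayFunction Γ K)
    {μ : ∀ X : Finset Γ, SignedMeasure (X → ℂ)} (hμ : ∀ x y, pairMoment μ x y < ⊤)
    (Λ : Finset Γ) (f : lp (fun _ : Γ => ℂ) 2) :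
    ∑ X ∈ Λ.powerset, ∫⁻ z : X → ℂ, ∑ x : X, smear K (fun x => ‖f x‖ₑ) x * ‖z x‖ₑ
      ∂(μ X).totalVariation ≤
      ENNReal.ofReal ((firstMoment μ Λ).toReal * pairSum K f (deltaComb Λ fun _ => 1)) := by
  rw [ENNReal.ofReal_mul ENNReal.toReal_nonneg, ENNReal.ofReal_toReal (firstMoment_lt_top μ hμ Λ).ne,
    hK.ofReal_pairSum, pairing_deltaComb]
  refine (sum_lintegral_le_firstMoment μ Λ _).trans (le_of_eq ?_)
  rw [← Finset.sum_coe_sort Λ]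
  simp

variable {H : Type*} [NormedAddCommGroup H] [InnerProductSpace ℂ H] [CompleteSpace H]
  {M : StarSubalgebra ℂ (H →L[ℂ] H)} {D : Submodule ℝ (lp (fun _ : Γ => ℂ) 2)}
  {σ : D →ₗ[ℝ] D →ₗ[ℝ] ℝ} {W : D → M}

/-- A family of multi-site perturbations `P_X = ∫ W(z · δ_X) μ_X(dz)`. -/
structure IsMultisitePerturbation (W : D → M) (μ : ∀ X : Finset Γ, SignedMeasure (X → ℂ))
    (V : ∀ X : Finset Γ, (X → ℂ) → M) (P : Finset Γ → M) : Prop where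
  mem : ∀ X, ∀ᵐ z ∂(μ X).totalVariation, deltaComb X z ∈ D
  eq : ∀ X z (h : deltaComb X z ∈ D), V X z = W ⟨deltaComb X z, h⟩
  norm_le : ∀ X z, ‖V X z‖ ≤ 1
  weakIntegral : ∀ X, IsWeakIntegral (μ X) (fun z => (V X z : H →L[ℂ] H)) (P X)

variable {μ : ∀ X : Finset Γ, SignedMeasure (X → ℂ)} {V : ∀ X : Finset Γ, (X → ℂ) → M}
  {P : Finset Γ → M} {κ c v : ℝ} {T : ℝ → (D →ₗ[ℝ] D)}

/-- The three weights describe a class of bounds stable under iteration: `w₁` for the desired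
pairing with `g`, `w₃` for the a priori constant, and `w₂` for the pairing with the indicator of `Λ`
into which one step turns that constant. -/
lemma IsMultisitePerturbation.norm_lie_evol_sub_conj_le (hV : IsMultisitePerturbation W μ V P)
    (hW : IsWeylSystem σ W) (hK : IsDecayFunction Γ K) (hκ0 : 0 ≤ κ)
    (hκ : ∀ x y, pairMoment μ x y ≤ ENNReal.ofReal (κ * K (dist x y))) (hc0 : 0 ≤ c)
    (hc : ∀ (t : ℝ) (f g : D), ‖1 - Complex.exp (Complex.I * (σ (T t f) g : ℂ))‖ ≤
      c * Real.exp (v * |t|) * pairSum (Γ := Γ) K f g)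
    (β : WStarDynamics M) (Λ : Finset Γ) (f g : D) (B : M) {s t : ℝ} (hst : |t - s| + |s| = |t|)
    {w₁ w₂ w₃ : ℝ} (hw₁ : 0 ≤ w₁) (hw₂ : 0 ≤ w₂) (hw₃ : 0 ≤ w₃)
    (hw : ∀ h : D, ‖⁅β.evol s (W h), B⁆‖ ≤ Real.exp (v * |s|) *
      (w₁ * pairSum (Γ := Γ) K h g + w₂ * pairSum (Γ := Γ) K h (deltaComb Λ fun _ => 1) + w₃)) :
    ‖⁅β.evol s ((∑ X ∈ Λ.powerset, P X) -
        W (T (t - s) f) * (∑ X ∈ Λ.powerset, P X) * W (-T (t - s) f)), B⁆‖ ≤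
      c * Real.exp (v * |t|) * (w₁ * (κ * (convConst Γ K).toReal ^ 2 * pairSum (Γ := Γ) K f g) +
        w₂ * (κ * (convConst Γ K).toReal ^ 2 * pairSum (Γ := Γ) K f (deltaComb Λ fun _ => 1)) +
        w₃ * ((firstMoment μ Λ).toReal * pairSum (Γ := Γ) K f (deltaComb Λ fun _ => 1))) := by
  set e : lp (fun _ : Γ => ℂ) 2 := deltaComb Λ fun _ => 1 with he
  set h₀ := T (t - s) f with hh₀
  set S : (X : Finset Γ) → lp (fun _ : Γ => ℂ) 2 → (X → ℂ) → ℝ≥0∞ :=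
    fun X u z => ∑ x : X, smear K (fun x => ‖u x‖ₑ) x * ‖z x‖ₑ with hS
  have hSm : ∀ X u, Measurable (S X u) := fun X u => by simp only [hS]; fun_prop
  have hSl : ∀ X (u : lp (fun _ : Γ => ℂ) 2) z,
      ENNReal.ofReal (pairSum K u (deltaComb X z)) = S X u z := fun X u z => by
    rw [hK.ofReal_pairSum, pairing_deltaComb]
  have hSr : ∀ X (u : lp (fun _ : Γ => ℂ) 2) z,
      ENNReal.ofReal (pairSum K (deltaComb X z) u) = S X u z := fun X u z => by
    rw [hK.ofReal_pairSum, pairing_comm, pairing_deltaComb]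
  have hfg := hK.pairSum_nonneg f g
  have hfe := hK.pairSum_nonneg f e
  have hX : ∀ X, ENNReal.ofReal ‖⁅β.evol s (P X - W h₀ * P X * W (-h₀)), B⁆‖ ≤
      ENNReal.ofReal (c * Real.exp (v * |t|)) * (ENNReal.ofReal w₁ *
          ∫⁻ z, S X f z * S X g z ∂(μ X).totalVariation +
        ENNReal.ofReal w₂ * ∫⁻ z, S X f z * S X e z ∂(μ X).totalVariation +
        ENNReal.ofReal w₃ * ∫⁻ z, S X f z ∂(μ X).totalVariation) := fun X => by
    have h1 := hW.ofReal_norm_lie_evol_sub_conj_le (hV.weakIntegral X) (hV.norm_le X) β s h₀ B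
      (k := fun z => ENNReal.ofReal (c * Real.exp (v * |t|)) *
        (ENNReal.ofReal w₁ * (S X f z * S X g z) + ENNReal.ofReal w₂ * (S X f z * S X e z) +
          ENNReal.ofReal w₃ * S X f z))
      ((hV.mem X).mono fun z hz => ⟨_, hV.eq X z hz, ?_⟩)
    · refine h1.trans (le_of_eq ?_)
      rw [lintegral_const_mul _ (by fun_prop), lintegral_add_left (by fun_prop),
        lintegral_add_left (by fun_prop), lintegral_const_mul _ (by fun_prop),
        lintegral_const_mul _ (by fun_prop), lintegral_const_mul _ (by fun_prop)]
    · rw [← hSl X f z, ← hSr X g z, ← hSr X e z]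
      have p1 := hK.pairSum_nonneg f (deltaComb X z)
      have p2 := hK.pairSum_nonneg (deltaComb X z) g
      have p3 := hK.pairSum_nonneg (deltaComb X z) e
      rw [← ENNReal.ofReal_mul p1, ← ENNReal.ofReal_mul p1, ← ENNReal.ofReal_mul hw₁,
        ← ENNReal.ofReal_mul hw₂, ← ENNReal.ofReal_mul hw₃,
        ← ENNReal.ofReal_add (by positivity) (by positivity),
        ← ENNReal.ofReal_add (by positivity) (by positivity),
        ← ENNReal.ofReal_mul (by positivity)]
      refine ENNReal.ofReal_le_ofReal ?_
      refine (mul_le_mul (hc (t - s) f ⟨deltaComb X z, hz⟩) (hw ⟨deltaComb X z, hz⟩)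
        (norm_nonneg _) (by positivity)).trans (le_of_eq ?_)
      -- As `s` lies between `0` and `t`, the factors `e^{v|t-s|}` and `e^{v|s|}` merge into
      -- `e^{v|t|}`; hence `v` enters the exponent only additively.
      rw [← hst, mul_add v, Real.exp_add]
      ring
  have hsum : ⁅β.evol s ((∑ X ∈ Λ.powerset, P X) - W h₀ * (∑ X ∈ Λ.powerset, P X) * W (-h₀)), B⁆ =
      ∑ X ∈ Λ.powerset, ⁅β.evol s (P X - W h₀ * P X * W (-h₀)), B⁆ := by
    rw [Finset.mul_sum, Finset.sum_mul, ← Finset.sum_sub_distrib, map_sum]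
    simp only [Ring.lie_def, Finset.sum_mul, Finset.mul_sum, Finset.sum_sub_distrib]
  rw [← ENNReal.ofReal_le_ofReal_iff (by positivity), hsum]
  calc _ ≤ ENNReal.ofReal (∑ X ∈ Λ.powerset, ‖⁅β.evol s (P X - W h₀ * P X * W (-h₀)), B⁆‖) :=
        ENNReal.ofReal_le_ofReal (norm_sum_le _ _)
    _ = ∑ X ∈ Λ.powerset, ENNReal.ofReal ‖⁅β.evol s (P X - W h₀ * P X * W (-h₀)), B⁆‖ :=
        ENNReal.ofReal_sum_of_nonneg fun _ _ => norm_nonneg _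
    _ ≤ _ := Finset.sum_le_sum fun X _ => hX X
    _ = ENNReal.ofReal (c * Real.exp (v * |t|)) * (ENNReal.ofReal w₁ *
          ∑ X ∈ Λ.powerset, ∫⁻ z, S X f z * S X g z ∂(μ X).totalVariation +
        ENNReal.ofReal w₂ * ∑ X ∈ Λ.powerset, ∫⁻ z, S X f z * S X e z ∂(μ X).totalVariation +
        ENNReal.ofReal w₃ * ∑ X ∈ Λ.powerset, ∫⁻ z, S X f z ∂(μ X).totalVariation) := by
        rw [← Finset.mul_sum]
        simp only [Finset.mul_sum, Finset.sum_add_distrib]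
    _ ≤ _ := by
        rw [ENNReal.ofReal_mul (p := c * Real.exp (v * |t|)) (by positivity),
          ENNReal.ofReal_add (by positivity) (by positivity),
          ENNReal.ofReal_add (by positivity) (by positivity), ENNReal.ofReal_mul hw₁,
          ENNReal.ofReal_mul hw₂, ENNReal.ofReal_mul hw₃]
        gcongr
        · exact sum_lintegral_smear_mul_smear_le hK hκ0 hκ Λ _ _
        · exact sum_lintegral_smear_mul_smear_le hK hκ0 hκ Λ _ _
        · exact sum_lintegral_smear_le hK
            (fun x y => (hκ x y).trans_lt ENNReal.ofReal_lt_top) Λ _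

/-- One step of the iteration of the integral inequality for `‖[β_t(W(f)), W(g)]‖`. -/
lemma IsMultisitePerturbation.norm_lie_evol_le (hV : IsMultisitePerturbation W μ V P)
    (hM : IsClosed (M : Set (H →L[ℂ] H)))
    (hW : IsWeylSystem σ W) (hK : IsDecayFunction Γ K) (hκ0 : 0 ≤ κ)
    (hκ : ∀ x y, pairMoment μ x y ≤ ENNReal.ofReal (κ * K (dist x y))) (hc0 : 0 ≤ c)
    (hT_zero : T 0 = LinearMap.id) (hT_add : ∀ s t, T (s + t) = T s ∘ₗ T t)
    (hc : ∀ (t : ℝ) (f g : D), ‖1 - Complex.exp (Complex.I * (σ (T t f) g : ℂ))‖ ≤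
      c * Real.exp (v * |t|) * pairSum (Γ := Γ) K f g)
    {α β : WStarDynamics M} (hα : ∀ t f, α.evol t (W f) = W (T t f)) (Λ : Finset Γ)
    (hβ : IsPerturbedDynamics α (∑ X ∈ Λ.powerset, P X) β) (g : D)
    {w₁ w₂ : ℝ → ℝ} {w₃ : ℝ} (hw₁ : ∀ s, 0 ≤ s → 0 ≤ w₁ s) (hw₂ : ∀ s, 0 ≤ s → 0 ≤ w₂ s)
    (hw₃ : 0 ≤ w₃) (hw₁c : Continuous w₁) (hw₂c : Continuous w₂)
    (hw : ∀ (s : ℝ) (h : D), ‖⁅β.evol s (W h), W g⁆‖ ≤ Real.exp (v * |s|) *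
      (w₁ |s| * pairSum (Γ := Γ) K h g + w₂ |s| * pairSum (Γ := Γ) K h (deltaComb Λ fun _ => 1) + w₃))
    (t : ℝ) (f : D) :
    ‖⁅β.evol t (W f), W g⁆‖ ≤ Real.exp (v * |t|) *
      ((c + c * κ * (convConst Γ K).toReal ^ 2 * ∫ s in (0 : ℝ)..|t|, w₁ s) * pairSum (Γ := Γ) K f g +
        (c * κ * (convConst Γ K).toReal ^ 2 * (∫ s in (0 : ℝ)..|t|, w₂ s) +
          c * (firstMoment μ Λ).toReal * w₃ * |t|) *
          pairSum (Γ := Γ) K f (deltaComb Λ fun _ => 1)) := by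
  have hfg := hK.pairSum_nonneg f g
  have hfe := hK.pairSum_nonneg f (deltaComb Λ fun _ => 1)
  set p := pairSum (Γ := Γ) K f g with hp
  set q := pairSum (Γ := Γ) K f (deltaComb Λ fun _ => 1) with hq
  set C := (convConst Γ K).toReal with hC
  set m := (firstMoment μ Λ).toReal with hm
  have hm0 : 0 ≤ m := ENNReal.toReal_nonneg
  have h1 := hW.norm_lie_perturbed_le hM hT_zero hT_add hα hβ t f g
    (b := fun s => c * Real.exp (v * |t|) * (w₁ s * (κ * C ^ 2 * p) + w₂ s * (κ * C ^ 2 * q) +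
      w₃ * (m * q))) (by fun_prop)
    (fun s hs => by have := hw₁ s hs; have := hw₂ s hs; positivity)
    (fun s _ hst => hV.norm_lie_evol_sub_conj_le hW hK hκ0 hκ hc0 hc β Λ f g (W g) hst
      (hw₁ _ (abs_nonneg s)) (hw₂ _ (abs_nonneg s)) hw₃ (hw s))
  refine h1.trans ((add_le_add_left (hc t f g) _).trans (le_of_eq ?_))
  have i1 : IntervalIntegrable (fun s => w₁ s * (κ * C ^ 2 * p)) volume 0 |t| :=
    (hw₁c.mul continuous_const).intervalIntegrable _ _
  have i2 : IntervalIntegrable (fun s => w₂ s * (κ * C ^ 2 * q)) volume 0 |t| :=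
    (hw₂c.mul continuous_const).intervalIntegrable _ _
  rw [intervalIntegral.integral_const_mul, intervalIntegral.integral_add (i1.add i2)
      intervalIntegrable_const, intervalIntegral.integral_add i1 i2,
    intervalIntegral.integral_mul_const, intervalIntegral.integral_mul_const,
    intervalIntegral.integral_const, smul_eq_mul, sub_zero]
  ring

/-- This makes `w₁ = c e^{ms}` a fixed point of the iteration `w₁ ↦ c + m ∫ w₁`. -/
lemma mul_integral_exp (c m r : ℝ) :
    m * ∫ s in (0 : ℝ)..r, c * Real.exp (m * s) = c * Real.exp (m * r) - c := by
  rw [← intervalIntegral.integral_const_mul,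
    intervalIntegral.integral_eq_sub_of_hasDerivAt (f := fun s => c * Real.exp (m * s))]
  · simp
  · intro s _
    have := (((hasDerivAt_id s).const_mul m).exp).const_mul c
    exact this.congr_deriv (by simp only [id]; ring)
  · exact Continuous.intervalIntegrable (by fun_prop) _ _

/-- The extra factor `s` in the remainder yields `1/(n + 2)` on integration; weakening it to `1/(n +
1)` produces the next factorial. -/
lemma mul_integral_pow_le {b m r : ℝ} (hb : 0 ≤ b) (hm : 0 ≤ m) (hr : 0 ≤ r) (n : ℕ) :
    m * ∫ s in (0 : ℝ)..r, b * s * ((m * s) ^ n / n.factorial) ≤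
      b * r * ((m * r) ^ (n + 1) / (n + 1).factorial) := by
  have h1 : ∀ s : ℝ, b * s * ((m * s) ^ n / n.factorial) =
      b * m ^ n / n.factorial * s ^ (n + 1) := fun s => by rw [mul_pow]; ring
  simp_rw [h1]
  rw [intervalIntegral.integral_const_mul, integral_pow, Nat.factorial_succ]
  have h2 : (0 : ℝ) < n.factorial := by exact_mod_cast n.factorial_pos
  have h3 : m * (b * m ^ n / n.factorial * ((r ^ (n + 1 + 1) - 0 ^ (n + 1 + 1)) /
      ((n + 1 : ℕ) + 1))) = b * r * (m * r) ^ (n + 1) / n.factorial * (1 / ((n : ℝ) + 2)) := by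
    rw [zero_pow (by omega)]
    push_cast
    field_simp
    ring
  have h4 : b * r * ((m * r) ^ (n + 1) / ((n + 1) * n.factorial : ℕ)) =
      b * r * (m * r) ^ (n + 1) / n.factorial * (1 / ((n : ℝ) + 1)) := by
    push_cast
    field_simp
  rw [h3, h4]
  gcongr
  norm_num

theorem IsMultisitePerturbation.norm_lie_evol_le_exp (hV : IsMultisitePerturbation W μ V P)
    (hM : IsClosed (M : Set (H →L[ℂ] H)))
    (hW : IsWeylSystem σ W) (hK : IsDecayFunction Γ K) (hκ0 : 0 ≤ κ)
    (hκ : ∀ x y, pairMoment μ x y ≤ ENNReal.ofReal (κ * K (dist x y))) (hc0 : 0 ≤ c)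
    (hv0 : 0 ≤ v)
    (hT_zero : T 0 = LinearMap.id) (hT_add : ∀ s t, T (s + t) = T s ∘ₗ T t)
    (hc : ∀ (t : ℝ) (f g : D), ‖1 - Complex.exp (Complex.I * (σ (T t f) g : ℂ))‖ ≤
      c * Real.exp (v * |t|) * pairSum (Γ := Γ) K f g)
    {α β : WStarDynamics M} (hα : ∀ t f, α.evol t (W f) = W (T t f)) (Λ : Finset Γ)
    (hβ : IsPerturbedDynamics α (∑ X ∈ Λ.powerset, P X) β) (t : ℝ) (f g : D) :
    ‖⁅β.evol t (W f), W g⁆‖ ≤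
      c * Real.exp ((v + c * κ * (convConst Γ K).toReal ^ 2) * |t|) * pairSum (Γ := Γ) K f g := by
  set m := c * κ * (convConst Γ K).toReal ^ 2 with hm
  have hm0 : 0 ≤ m := by positivity
  -- The factor `2` is the trivial bound on a commutator of two unitaries.
  set b := c * (firstMoment μ Λ).toReal * 2 with hb
  have hb0 : 0 ≤ b := by positivity
  have key : ∀ (n : ℕ) (s : ℝ) (h : D), ‖⁅β.evol s (W h), W g⁆‖ ≤ Real.exp (v * |s|) *
      (c * Real.exp (m * |s|) * pairSum (Γ := Γ) K h g +
        b * |s| * ((m * |s|) ^ n / n.factorial) * pairSum (Γ := Γ) K h (deltaComb Λ fun _ => 1)) := by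
    intro n
    induction n with
    | zero =>
      intro s h
      have hfg := hK.pairSum_nonneg h g
      -- The first step starts from the constant bound alone, `w₃ = 2`, and trades it for a term
      -- linear in `|s|`.
      have h1 := hV.norm_lie_evol_le hM hW hK hκ0 hκ hc0 hT_zero hT_add hc hα Λ hβ g
        (w₁ := fun _ => 0) (w₂ := fun _ => 0) (w₃ := 2) (fun _ _ => le_rfl) (fun _ _ => le_rfl)
        zero_le_two continuous_const continuous_const (fun s h => by
          have h2 := hW.norm_lie_evol_le_two β s h g
          have h3 : 1 ≤ Real.exp (v * |s|) := Real.one_le_exp (by positivity)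
          linarith) s h
      refine h1.trans ?_
      have h4 : 1 ≤ Real.exp (m * |s|) := Real.one_le_exp (by positivity)
      have h5 : c ≤ c * Real.exp (m * |s|) := le_mul_of_one_le_right hc0 h4
      simp only [intervalIntegral.integral_zero, mul_zero, add_zero, zero_add, pow_zero,
        Nat.factorial_zero, Nat.cast_one, div_one, mul_one]
      gcongr
    | succ n ih =>
      intro s h
      have hfe := hK.pairSum_nonneg h (deltaComb Λ fun _ => 1)
      have h1 := hV.norm_lie_evol_le hM hW hK hκ0 hκ hc0 hT_zero hT_add hc hα Λ hβ g
        (w₁ := fun s => c * Real.exp (m * s)) (w₂ := fun s => b * s * ((m * s) ^ n / n.factorial))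
        (w₃ := 0) (fun _ _ => by positivity) (fun _ _ => by positivity) le_rfl (by fun_prop)
        (by fun_prop) (fun s h => by simpa only [add_zero] using ih s h) s h
      refine h1.trans ?_
      -- The main term reproduces itself exactly; only the remainder changes.
      rw [← hm, mul_integral_exp, mul_zero, zero_mul, add_zero, add_sub_cancel]
      exact mul_le_mul_of_nonneg_left (add_le_add le_rfl (mul_le_mul_of_nonneg_right
        (mul_integral_pow_le hb0 hm0 (abs_nonneg s) n) hfe)) (Real.exp_pos _).le
  have hlim : Filter.Tendsto (fun n : ℕ => Real.exp (v * |t|) *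
      (c * Real.exp (m * |t|) * pairSum (Γ := Γ) K f g +
        b * |t| * ((m * |t|) ^ n / n.factorial) * pairSum (Γ := Γ) K f (deltaComb Λ fun _ => 1)))
      Filter.atTop (nhds (Real.exp (v * |t|) * (c * Real.exp (m * |t|) * pairSum (Γ := Γ) K f g +
        b * |t| * 0 * pairSum (Γ := Γ) K f (deltaComb Λ fun _ => 1)))) :=
    ((((FloorSemiring.tendsto_pow_div_factorial_atTop _).const_mul _).mul_const _).const_add
      _).const_mul _
  refine (ge_of_tendsto' hlim fun n => key n t f).trans (le_of_eq ?_)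
  rw [add_mul, Real.exp_add]
  ring

end LiebRobinsonBound

/-! ### The GNS representation as an instance of the abstract setting -/

section GNS

variable {Γ : Type*} {D : Submodule ℝ (lp (fun _ : Γ => ℂ) 2)} {σ : D →ₗ[ℝ] D →ₗ[ℝ] ℝ}
  {ρ : CCRAlgebra σ →ₚ[ℂ] ℂ}

lemma isMultisitePerturbation_gnsWeylAt (hσ : ∀ f g, σ f g = -σ g f)
    {μ : ∀ X : Finset Γ, SignedMeasure (X → ℂ)}
    (hμ_D : ∀ X, ∀ᵐ z ∂(μ X).totalVariation, deltaComb X z ∈ D) {P : Finset Γ → gnsAlgebra ρ}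
    (hP : ∀ X, IsWeakIntegral (μ X) (weylAt ρ X) (P X)) :
    IsMultisitePerturbation (fun f : D => gnsRep ρ (weyl σ f)) μ (gnsWeylAt ρ) P where
  mem := hμ_D
  eq _ _ h := gnsWeylAt_of_mem ρ h
  norm_le := norm_gnsWeylAt_le hσ ρ
  weakIntegral := hP

end GNS

end LiebRobinson

end

theorem mainTheorem2 {Γ : Type*} [MetricSpace Γ]
    -- the decay function
    (F : ℝ → ℝ) (hF : IsDecayFunction Γ F)
    -- the space of test functions with its symplectic form
    (D : Submodule ℝ (lp (fun _ : Γ => ℂ) 2)) (σ : D →ₗ[ℝ] D →ₗ[ℝ] ℝ)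
    (hσ_skew : ∀ f g, σ f g = -σ g f) (hσ_nondeg : ∀ g, (∀ f, σ f g = 0) → g = 0)
    -- the harmonic dynamics
    (T : ℝ → (D →ₗ[ℝ] D)) (hT_zero : T 0 = LinearMap.id)
    (hT_add : ∀ s t, T (s + t) = T s ∘ₗ T t) (hT_symp : ∀ t f g, σ (T t f) (T t g) = σ f g)
    (τ₀ : ℝ → (CCRAlgebra σ ≃⋆ₐ[ℂ] CCRAlgebra σ))
    (hτ₀ : ∀ t f, τ₀ t (weyl σ f) = weyl σ (T t f))
    -- its Lieb–Robinson type bound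
    (a₀ : ℝ) (ha₀ : 0 < a₀) (c v : ℝ → ℝ)
    (hcv : ∀ a, 0 < a → a ≤ a₀ → 0 < c a ∧ 0 < v a ∧ ∀ (t : ℝ) (f g : D),
      ‖1 - Complex.exp (Complex.I * (σ (T t f) g : ℂ))‖ ≤
        c a * Real.exp (v a * |t|) * pairSum (expWeight F a) (f : lp (fun _ : Γ => ℂ) 2) g)
    -- the regular invariant state, and the `W^*`-dynamical system in its GNS representation
    (ρ : CCRAlgebra σ →ₚ[ℂ] ℂ) (hρ : IsRegularState ρ) (hρ_inv : ∀ t A, ρ (τ₀ t A) = ρ A)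
    (α : WStarDynamics (gnsAlgebra ρ)) (hα : ∀ t A, α.evol t (gnsRep ρ A) = gnsRep ρ (τ₀ t A))
    -- the multi-site perturbations
    (μ : ∀ X : Finset Γ, SignedMeasure (X → ℂ)) (hμ_even : ∀ X, (μ X).map (fun z => -z) = μ X)
    (hμ_D : ∀ X, ∀ᵐ z ∂(μ X).totalVariation, deltaComb X z ∈ D)
    (P : Finset Γ → gnsAlgebra ρ) (hP : ∀ X, IsWeakIntegral (μ X) (weylAt ρ X) (P X))
    (a₁ : ℝ) (ha₁ : 0 < a₁) (κ : ℝ → ℝ)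
    (hκ : ∀ a, 0 < a → a ≤ a₁ → 0 < κ a ∧ ∀ x₁ x₂ : Γ,
      pairMoment μ x₁ x₂ ≤ ENNReal.ofReal (κ a * expWeight F a (dist x₁ x₂)))
    -- the perturbed finite-volume dynamics
    (τ : Finset Γ → WStarDynamics (gnsAlgebra ρ))
    (hτ : ∀ Λ : Finset Γ, IsPerturbedDynamics α (∑ X ∈ Λ.powerset, P X) (τ Λ))
    (a : ℝ) (ha : 0 < a) (ha_le : a ≤ min a₀ a₁) (Λ : Finset Γ) (t : ℝ) (f g : D) :
    ‖⁅(τ Λ).evol t (gnsRep ρ (weyl σ f)), gnsRep ρ (weyl σ g)⁆‖ ≤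
      c a * Real.exp ((v a + c a * κ a * (convConst Γ (expWeight F a)).toReal ^ 2) * |t|) *
        pairSum (expWeight F a) (f : lp (fun _ : Γ => ℂ) 2) g := by
  exact (isMultisitePerturbation_gnsWeylAt hσ_skew hμ_D hP).norm_lie_evol_le_exp
    (isClosed_weakClosure _) (isWeylSystem_gnsRep hσ_skew ρ) (hF.expWeight ha.le)
    (hκ a ha (ha_le.trans (min_le_right _ _))).1.le (hκ a ha (ha_le.trans (min_le_right _ _))).2
    (hcv a ha (ha_le.trans (min_le_left _ _))).1.le
    (hcv a ha (ha_le.trans (min_le_left _ _))).2.1.le hT_zero hT_add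
    (hcv a ha (ha_le.trans (min_le_left _ _))).2.2
    (fun s h => (hα s (weyl σ h)).trans (congrArg (gnsRep ρ) (hτ₀ s h))) Λ (hτ Λ) t f g
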